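/- Let $G$ be a locally finite, connected, (vertex-)transitive graph, and let $(X_n)_{n\ge 0}$ be simple random walk on $G$ started from a vertex $x$. Assume that the walk is transient. Put $u_n=\mathbb{P}_x[X_n=x]$, $f_n=\mathbb{P}_x[X_n=x,\ X_i\ne x\text{ for }0<i<n]$ for $n\ge 1$, and $f_0=0$ (by transitivity these do not depend on $x$). Let $\rho=\limsup_{n\to\infty}u_n^{1/n}$ be the spectral radius, $a_n=u_n/\rho^n$, $F(z)=\sum_{n\ge 0}f_nz^n$, and let $\mathsf d=\gcd\{n\ge 1: u_n>0\}$ be the period. The following two conditions are equivalent: (1) for every $\varepsilon>0$ there is an integer $N>0$ such that $\sum_{i=N}^{n-N}u_iu_{n-i}\le\varepsilon u_n$ for all $n\ge 2N$; (2) for every $\varepsilon>0$ there is an integer $N>0$ such that $\sum_{i=N}^{n-N}a_ia_{n-i}\le\varepsilon a_n$ for all $n\ge 2N$. If they hold, then (a) $f_n$ and $u_n$ are of the same order: there is a constant $c>0$ such that $f_n\le c\,u_n$ and $u_n\le c\,f_n$ for all $n\ge 1$; (b) $\mathsf d\in\{1,2\}$, the series $F(\rho^{-1})$ converges, and $$\lim_{n\to\infty,\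 \mathsf d\mid n}\frac{f_n}{u_n}=\bigl(1-F(\rho^{-1})\bigr)^2\in(0,1).$$ -/

import Mathlib

open Filter Topology

namespace SRW

noncomputable section

/-- A graph is (vertex-)transitive if its automorphism group acts transitively on the vertices. -/
def IsTransitive {V : Type*} (G : SimpleGraph V) : Prop :=
  ∀ x y : V, ∃ φ : G ≃g G, φ x = y

/-- One step of simple random walk from `x`: a uniformly chosen neighbour of `x`.
(At a vertex without neighbours the walk stays put; in a connected graph this concerns only the
one-vertex graph, on which the walk is then recurrent.) -/
def step {V : Type*} (G : SimpleGraph V) [G.LocallyFinite] (x : V) : PMF V :=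
  open Classical in
  if h : (G.neighborFinset x).Nonempty then PMF.uniformOfFinset (G.neighborFinset x) h
  else PMF.pure x

/-- The joint law of the first `n + 1` positions `(X_0, …, X_n)` of simple random walk started
from `x`: `X_0 = x`, and given `(X_0, …, X_n)` the next position is drawn from `step G X_n`. -/
def pathLaw {V : Type*} (G : SimpleGraph V) [G.LocallyFinite] (x : V) :
    (n : ℕ) → PMF (Fin (n + 1) → V)
  | 0 => PMF.pure (fun _ => x)
  | n + 1 => (pathLaw G x n).bind fun ω =>
      (step G (ω (Fin.last n))).map fun y => (Fin.snoc ω y : Fin (n + 2) → V)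

/-- The `n`-step return probability `u_n(x) = P_x[X_n = x]`. -/
def returnProb {V : Type*} (G : SimpleGraph V) [G.LocallyFinite] (x : V) (n : ℕ) : ℝ :=
  ((pathLaw G x n).toOuterMeasure {ω | ω (Fin.last n) = x}).toReal

/-- The first return probability `f_n(x) = P_x[X_n = x, X_i ≠ x for 0 < i < n]` for `n ≥ 1`,
with the convention `f_0(x) = 0`. -/
def firstReturnProb {V : Type*} (G : SimpleGraph V) [G.LocallyFinite] (x : V) (n : ℕ) : ℝ :=
  if n = 0 then 0
  else ((pathLaw G x n).toOuterMeasure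
    {ω | ω (Fin.last n) = x ∧ ∀ i : Fin (n + 1), 0 < i → i < Fin.last n → ω i ≠ x}).toReal

/-- Simple random walk on `G` is transient: from every vertex, the expected number
`∑ u_n(x)` of visits to the starting point is finite. -/
def IsTransient {V : Type*} (G : SimpleGraph V) [G.LocallyFinite] : Prop :=
  ∀ x : V, Summable (returnProb G x)

/-- The spectral radius `ρ = limsup u_n(x)^{1/n}`. -/
def spectralRadius {V : Type*} (G : SimpleGraph V) [G.LocallyFinite] (x : V) : ℝ :=
  limsup (fun n : ℕ => returnProb G x n ^ (1 / (n : ℝ))) atTop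

/-- The normalized return probability `a_n(x) = u_n(x) / ρ ^ n`. -/
def normalizedReturnProb {V : Type*} (G : SimpleGraph V) [G.LocallyFinite] (x : V) (n : ℕ) : ℝ :=
  returnProb G x n / spectralRadius G x ^ n

/-- The period `gcd {n ≥ 1 : u_n(x) > 0}` of simple random walk. -/
def period {V : Type*} (G : SimpleGraph V) [G.LocallyFinite] (x : V) : ℕ :=
  Nat.setGcd {n : ℕ | 1 ≤ n ∧ 0 < returnProb G x n}

/-- The value `F(z) = ∑ f_n(x) z ^ n` of the first return generating function at a real `z`
(meaningful where the series converges). -/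
def firstReturnGen {V : Type*} (G : SimpleGraph V) [G.LocallyFinite] (x : V) (z : ℝ) : ℝ :=
  ∑' n : ℕ, firstReturnProb G x n * z ^ n

/-- For every `ε > 0` there is `N > 0` with `∑_{i=N}^{n-N} w_i w_{n-i} ≤ ε w_n` for all
`n ≥ 2N`. -/
def SmallMiddleSums (w : ℕ → ℝ) : Prop :=
  ∀ ε : ℝ, 0 < ε → ∃ N : ℕ, 0 < N ∧ ∀ n : ℕ, 2 * N ≤ n →
    ∑ i ∈ Finset.Icc N (n - N), w i * w (n - i) ≤ ε * w n

end

end SRW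

/-! Dividing by `ρ ^ n` turns `u_i u_{n-i}` into `a_i a_{n-i}` with the common factor `ρ ^ (-n)`, so
the two conditions are the same inequality with the same `N`.

For the rest, let `D` be the period, `b_k = a_{Dk}` and `φ_k = f_{Dk} / ρ ^ (Dk)`; then `b = δ_0 + φ
* b`. Suppose `b_{k+1} / b_k → 1`. Small middle sums make `b`, hence `φ ≤ b`, summable. Put `Φ = ∑
φ` and `g = φ / b`. In the renewal equation divided by `b_n`, only the two ends of the convolution
survive: one end is asymptotically `(b * g)_n`, the other tends to `Φ`. Hence `b * g → 1 - Φ`, and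
`g = b * g - φ * (b * g)` tends to `(1 - Φ) - Φ (1 - Φ) = (1 - Φ) ^ 2` (`renewal_ratio_tendsto`).
Summing the renewal equation gives `(1 - Φ) ∑ b = 1` with `∑ b > 1`, so the limit lies in `(0, 1)`.

The ratio limit comes from reversibility and transitivity. Even return probabilities are log-convex
by Cauchy–Schwarz, so their ratios increase to a limit `σ ^ 2`, and `σ = ρ`. For odd steps take `m`
with `u_m > 0`: by transitivity `P ^ m` has constant diagonal `u_m`, so `P ^ m - u_m` still has
nonnegative entries and its norm on the cyclic subspace of `x` is at most `σ ^ m - u_m`. This keeps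
the spectrum away from `-σ ^ m` when `m` is odd and gives `u_{2k+m} / u_{2k} → σ ^ m`. Only moments
`p ↦ p(P)(x, x)` of polynomials are needed, not the spectral theorem.

The two-sided comparison at finitely many `n` needs `f_n > 0` whenever `u_n > 0`. Transience forces
degree at least two, so a first-return path can be lengthened by a back-and-forth detour. -/

namespace SRW

open Finset.HasAntidiagonal (antidiagonal)

/-! ### Renewal sequences with ratio limit one -/

section Renewal

variable {b φ : ℕ → ℝ}

/-- Tannery's theorem for the convolution of a summable and a convergent sequence. -/
theorem tendsto_sum_antidiagonal_mul {h : ℕ → ℝ} {κ : ℝ} (hφ : ∀ n, 0 ≤ φ n)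
    (hs : Summable φ) (hh : Tendsto h atTop (𝓝 κ)) :
    Tendsto (fun n => ∑ p ∈ antidiagonal n, φ p.1 * h p.2) atTop
      (𝓝 ((∑' n, φ n) * κ)) := by
  obtain ⟨C, hC⟩ := hh.norm.bddAbove_range
  have hC' : ∀ n, ‖h n‖ ≤ C := fun n => hC ⟨n, rfl⟩
  have h0 : 0 ≤ C := (norm_nonneg _).trans (hC' 0)
  have key : Tendsto (fun n => ∑' i, if i ≤ n then φ i * h (n - i) else 0) atTop
      (𝓝 (∑' i, φ i * κ)) := by
    refine tendsto_tsum_of_dominated_convergence (bound := fun i => φ i * C)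
      (hs.mul_right C) (fun i => ?_) (Eventually.of_forall fun n i => ?_)
    · have h1 : Tendsto (fun n => φ i * h (n - i)) atTop (𝓝 (φ i * κ)) :=
        (hh.comp (tendsto_sub_atTop_nat i)).const_mul _
      refine h1.congr' ?_
      filter_upwards [eventually_ge_atTop i] with n hn
      rw [if_pos hn]
    · split_ifs
      · rw [norm_mul, Real.norm_of_nonneg (hφ i)]
        exact mul_le_mul_of_nonneg_left (hC' _) (hφ i)
      · simpa using mul_nonneg (hφ i) h0
  rw [tsum_mul_right] at key
  refine key.congr fun n => ?_
  rw [Finset.Nat.sum_antidiagonal_eq_sum_range_succ (fun i j => φ i * h j),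
    tsum_eq_sum (s := Finset.range n.succ)]
  · refine Finset.sum_congr rfl fun i hi => ?_
    rw [if_pos (Nat.lt_succ_iff.mp (Finset.mem_range.mp hi))]
  · intro i hi
    rw [if_neg (by simpa [Nat.lt_succ_iff] using hi)]

theorem tendsto_shift_div (hr : Tendsto (fun n => b (n + 1) / b n) atTop (𝓝 1)) (i : ℕ) :
    Tendsto (fun n => b (n + i) / b n) atTop (𝓝 1) := by
  have hne : ∀ᶠ n in atTop, b n ≠ 0 := by
    filter_upwards [hr.eventually_ne one_ne_zero] with n hn h0
    exact hn (by rw [h0, div_zero])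
  induction i with
  | zero =>
    refine (tendsto_const_nhds (x := (1 : ℝ))).congr' ?_
    filter_upwards [hne] with n hn
    simp [hn]
  | succ i ih =>
    have h2 := (hr.comp (tendsto_add_atTop_nat i)).mul ih
    rw [one_mul] at h2
    refine h2.congr' ?_
    filter_upwards [(tendsto_add_atTop_nat i).eventually hne] with n hn
    simp only [Function.comp]
    rw [div_mul_div_cancel₀ hn, add_assoc]

theorem tendsto_sub_div (hr : Tendsto (fun n => b (n + 1) / b n) atTop (𝓝 1)) (i : ℕ) :
    Tendsto (fun n => b (n - i) / b n) atTop (𝓝 1) := by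
  have h1 := ((tendsto_shift_div hr i).inv₀ one_ne_zero).comp (tendsto_sub_atTop_nat i)
  rw [inv_one] at h1
  refine h1.congr' ?_
  filter_upwards [eventually_ge_atTop i] with n hn
  simp only [Function.comp, inv_div, Nat.sub_add_cancel hn]

/-- Divide the middle-sum bound by `b n`, keep only indices up to a fixed `M`, and let `n → ∞`:
every block sum `∑_{i=N}^{M} b i` is at most `1`. -/
theorem SmallMiddleSums.summable (hsm : SmallMiddleSums b) (hb : ∀ n, 0 ≤ b n)
    (hr : Tendsto (fun n => b (n + 1) / b n) atTop (𝓝 1)) : Summable b := by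
  have hne : ∀ᶠ n in atTop, b n ≠ 0 := by
    filter_upwards [hr.eventually_ne one_ne_zero] with n hn h0
    exact hn (by rw [h0, div_zero])
  obtain ⟨N, hN, hNn⟩ := hsm 1 one_pos
  have key : ∀ M, ∑ i ∈ Finset.Icc N M, b i ≤ 1 := by
    intro M
    have hlim : Tendsto (fun n => ∑ i ∈ Finset.Icc N M, b i * (b (n - i) / b n)) atTop
        (𝓝 (∑ i ∈ Finset.Icc N M, b i * 1)) :=
      tendsto_finsetSum _ fun i _ => (tendsto_sub_div hr i).const_mul _
    simp only [mul_one] at hlim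
    refine le_of_tendsto hlim ?_
    filter_upwards [eventually_ge_atTop (2 * N + M), hne] with n hn hbn
    have hbn : 0 < b n := lt_of_le_of_ne (hb n) (Ne.symm hbn)
    have h1 := hNn n (by omega)
    have h2 : ∑ i ∈ Finset.Icc N M, b i * b (n - i) ≤
        ∑ i ∈ Finset.Icc N (n - N), b i * b (n - i) :=
      Finset.sum_le_sum_of_subset_of_nonneg (Finset.Icc_subset_Icc le_rfl (by omega))
        fun i _ _ => mul_nonneg (hb _) (hb _)
    calc ∑ i ∈ Finset.Icc N M, b i * (b (n - i) / b n)
        = (∑ i ∈ Finset.Icc N M, b i * b (n - i)) / b n := by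
          rw [Finset.sum_div]
          exact Finset.sum_congr rfl fun i _ => by rw [mul_div_assoc]
      _ ≤ 1 := by
          rw [div_le_one hbn]
          linarith
  refine summable_of_sum_range_le (c := ∑ i ∈ Finset.range N, b i + 1) hb fun n => ?_
  calc ∑ i ∈ Finset.range n, b i
      ≤ ∑ i ∈ Finset.range N ∪ Finset.Icc N n, b i := by
        refine Finset.sum_le_sum_of_subset_of_nonneg (fun i hi => ?_) fun i _ _ => hb i
        simp only [Finset.mem_range, Finset.mem_union, Finset.mem_Icc] at hi ⊢
        omega
    _ ≤ ∑ i ∈ Finset.range N, b i + ∑ i ∈ Finset.Icc N n, b i := by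
        rw [← Finset.sum_union_inter]
        exact le_add_of_nonneg_right (Finset.sum_nonneg fun i _ => hb i)
    _ ≤ _ := by linarith [key n]

theorem renewal_le (hb : ∀ n, 0 ≤ b n) (hφ : ∀ n, 0 ≤ φ n) (hb0 : b 0 = 1) (hφ0 : φ 0 = 0)
    (hren : ∀ n, 1 ≤ n → b n = ∑ p ∈ antidiagonal n, φ p.1 * b p.2) (n : ℕ) :
    φ n ≤ b n := by
  rcases Nat.eq_zero_or_pos n with rfl | hn
  · rw [hφ0, hb0]; exact zero_le_one
  · rw [hren n hn]
    have := Finset.single_le_sum (f := fun p : ℕ × ℕ => φ p.1 * b p.2)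
      (s := antidiagonal n) (fun p _ => mul_nonneg (hφ _) (hb _))
      (show (n, 0) ∈ antidiagonal n by simp)
    simpa [hb0] using this

/-- Summing the renewal equation over `n` gives `B = 1 + Φ B`. -/
theorem renewal_tsum (hb : ∀ n, 0 ≤ b n) (hφ : ∀ n, 0 ≤ φ n) (hb0 : b 0 = 1) (hφ0 : φ 0 = 0)
    (hren : ∀ n, 1 ≤ n → b n = ∑ p ∈ antidiagonal n, φ p.1 * b p.2)
    (hs : Summable b) : (1 - ∑' n, φ n) * ∑' n, b n = 1 := by
  have hsφ : Summable φ := Summable.of_nonneg_of_le hφ (renewal_le hb hφ hb0 hφ0 hren) hs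
  have hprod := tsum_mul_tsum_eq_tsum_sum_antidiagonal_of_summable_norm hsφ.norm hs.norm
  have h1 : ∀ n, b n = (if n = 0 then 1 else 0) +
      ∑ p ∈ antidiagonal n, φ p.1 * b p.2 := by
    intro n
    rcases Nat.eq_zero_or_pos n with rfl | hn
    · simp [hb0, hφ0]
    · rw [if_neg hn.ne', zero_add]; exact hren n hn
  have hsum : Summable fun n => ∑ p ∈ antidiagonal n, φ p.1 * b p.2 :=
    summable_sum_mul_antidiagonal_of_summable_mul
      (f := φ) (g := b) (summable_mul_of_summable_norm hsφ.norm hs.norm)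
  have h2 : ∑' n, b n = 1 + (∑' n, φ n) * ∑' n, b n := by
    rw [hprod, tsum_congr h1, Summable.tsum_add _ hsum, tsum_ite_eq]
    exact (hasSum_ite_eq 0 (1 : ℝ)).summable
  linarith

-- As formal power series `(1 - φ) b = 1`; multiplying by `g` recovers `g` from its convolution with
-- `b`.
open PowerSeries in
theorem renewal_convolution_inverse (hb0 : b 0 = 1) (hφ0 : φ 0 = 0)
    (hren : ∀ n, 1 ≤ n → b n = ∑ p ∈ antidiagonal n, φ p.1 * b p.2)
    (g : ℕ → ℝ) (n : ℕ) :
    (∑ p ∈ antidiagonal n, b p.1 * g p.2) -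
      ∑ q ∈ antidiagonal n, φ q.1 * ∑ p ∈ antidiagonal q.2, b p.1 * g p.2
      = g n := by
  have h1 : (1 - mk φ) * mk b = 1 := by
    rw [sub_mul, one_mul, sub_eq_iff_eq_add]
    ext n
    rw [coeff_mk, map_add, coeff_one, coeff_mul]
    simp only [coeff_mk]
    rcases Nat.eq_zero_or_pos n with rfl | hn
    · simp [hb0, hφ0]
    · rw [if_neg hn.ne', zero_add]; exact hren n hn
  have h2 : mk b * mk g - mk φ * (mk b * mk g) = mk g := by
    calc mk b * mk g - mk φ * (mk b * mk g) = ((1 - mk φ) * mk b) * mk g := by ring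
      _ = mk g := by rw [h1, one_mul]
  have h3 := congrArg (coeff n) h2
  simpa [coeff_mul] using h3

/-- The convolution of `b` with the ratios `φ / b` converges to `1 - ∑ φ`. -/
theorem tendsto_convolution_ratio (hb : ∀ n, 0 ≤ b n) (hφ : ∀ n, 0 ≤ φ n) (hb0 : b 0 = 1)
    (hφ0 : φ 0 = 0) (hren : ∀ n, 1 ≤ n → b n = ∑ p ∈ antidiagonal n, φ p.1 * b p.2)
    (hr : Tendsto (fun n => b (n + 1) / b n) atTop (𝓝 1)) (hsm : SmallMiddleSums b) :
    Tendsto (fun n => ∑ p ∈ antidiagonal n, b p.1 * (φ p.2 / b p.2)) atTop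
      (𝓝 (1 - ∑' n, φ n)) := by
  have hs := hsm.summable hb hr
  have hle := renewal_le hb hφ hb0 hφ0 hren
  have hsφ : Summable φ := Summable.of_nonneg_of_le hφ hle hs
  have hne : ∀ᶠ n in atTop, b n ≠ 0 := by
    filter_upwards [hr.eventually_ne one_ne_zero] with n hn h0
    exact hn (by rw [h0, div_zero])
  set g : ℕ → ℝ := fun n => φ n / b n with hg
  have hg0 : ∀ n, 0 ≤ g n := fun n => div_nonneg (hφ n) (hb n)
  have hg1 : ∀ n, g n ≤ 1 := fun n => div_le_one_of_le₀ (hle n) (hb n)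
  -- Where `b n = 0` the quotient is the default value `0`, which is harmless since `φ n ≤ b n`
  -- forces `φ n = 0`.
  have hgb : ∀ n, g n * b n = φ n := by
    intro n
    rcases eq_or_ne (b n) 0 with h0 | h0
    · have : φ n = 0 := le_antisymm (h0 ▸ hle n) (hφ n)
      rw [h0, this, mul_zero]
    · exact div_mul_cancel₀ _ h0
  rw [Metric.tendsto_nhds]
  intro ε hε
  -- Five errors of size at most `ε / 8` occur: the middle sum, the tails of `b` and `φ`, and the
  -- two boundary sums.
  obtain ⟨N₁, hN₁, hmid⟩ := hsm (ε / 8) (by positivity)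
  have htail : ∀ᶠ N in atTop, ∑' i, b (i + N) < ε / 8 :=
    (tendsto_sum_nat_add b).eventually_lt_const (by positivity)
  have htailφ : ∀ᶠ N in atTop, ∑' i, φ (i + N) < ε / 8 :=
    (tendsto_sum_nat_add φ).eventually_lt_const (by positivity)
  obtain ⟨N, hNb, hNφ, hNN⟩ := (htail.and (htailφ.and (eventually_ge_atTop N₁))).exists
  have hbt : ∀ n, ∑ i ∈ Finset.Ico N n, b i ≤ ε / 8 := by
    intro n
    rw [Finset.sum_Ico_eq_sum_range]
    refine le_trans ?_ hNb.le
    have := ((summable_nat_add_iff N).mpr hs).sum_le_tsum (Finset.range (n - N))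
      (fun i _ => hb _)
    simpa [add_comm] using this
  have hφt : (∑' n, φ n) = ∑ i ∈ Finset.range N, φ i + ∑' i, φ (i + N) :=
    (hsφ.sum_add_tsum_nat_add N).symm
  have hφt0 : 0 ≤ ∑' i, φ (i + N) := tsum_nonneg fun i => hφ _
  -- the two boundary sums
  have hS1 : Tendsto (fun n => ∑ i ∈ Finset.range N, b i * |b (n - i) / b n - 1|) atTop
      (𝓝 0) := by
    have : Tendsto (fun n => ∑ i ∈ Finset.range N, b i * |b (n - i) / b n - 1|) atTop
        (𝓝 (∑ i ∈ Finset.range N, b i * |(1 : ℝ) - 1|)) :=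
      tendsto_finsetSum _ fun i _ => (((tendsto_sub_div hr i).sub_const 1).abs).const_mul _
    simpa using this
  have hS3 : Tendsto (fun n => ∑ i ∈ Finset.range N, φ i * (b (n - i) / b n)) atTop
      (𝓝 (∑ i ∈ Finset.range N, φ i)) := by
    have : Tendsto (fun n => ∑ i ∈ Finset.range N, φ i * (b (n - i) / b n)) atTop
        (𝓝 (∑ i ∈ Finset.range N, φ i * 1)) :=
      tendsto_finsetSum _ fun i _ => (tendsto_sub_div hr i).const_mul _
    simpa using this
  have hS1' := hS1.eventually_lt_const (show (0 : ℝ) < ε / 8 by positivity)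
  have hS3' := (Metric.tendsto_nhds.mp hS3) (ε / 8) (by positivity)
  filter_upwards [hS1', hS3', hne, eventually_ge_atTop (2 * N + 2)] with n h1 h3 hbn hn
  have hbn : 0 < b n := lt_of_le_of_ne (hb n) (Ne.symm hbn)
  -- the renewal equation, divided by `b n` and split in three
  have hren' : b n = ∑ i ∈ Finset.range (n + 1), b i * φ (n - i) := by
    rw [hren n (by omega), ← Finset.Nat.sum_antidiagonal_swap,
      Finset.Nat.sum_antidiagonal_eq_sum_range_succ_mk]
    exact Finset.sum_congr rfl fun i _ => mul_comm _ _
  have hsplit : ∀ F : ℕ → ℝ, ∑ i ∈ Finset.range (n + 1), F i =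
      ∑ i ∈ Finset.range N, F i + ∑ i ∈ Finset.Ico N (n - N + 1), F i +
        ∑ i ∈ Finset.range N, F (n - i) := by
    intro F
    rw [Finset.range_eq_Ico, ← Finset.sum_Ico_consecutive F (Nat.zero_le N) (by omega : N ≤ n + 1),
      ← Finset.sum_Ico_consecutive F (by omega : N ≤ n - N + 1) (by omega : n - N + 1 ≤ n + 1),
      ← add_assoc]
    congr 1
    · rw [Finset.range_eq_Ico]
    · rw [Finset.range_eq_Ico, Finset.sum_Ico_reflect F 0 (by omega : N ≤ n + 1)]
      simp [show n + 1 - N = n - N + 1 by omega]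
  have hR := hren'
  rw [hsplit] at hR
  have hmidle : ∑ i ∈ Finset.Ico N (n - N + 1), b i * φ (n - i) ≤ ε / 8 * b n := by
    refine le_trans ?_ (hmid n (by omega))
    refine (Finset.sum_le_sum fun i _ => mul_le_mul_of_nonneg_left (hle (n - i)) (hb i)).trans ?_
    refine Finset.sum_le_sum_of_subset_of_nonneg (fun i hi => ?_)
      fun i _ _ => mul_nonneg (hb _) (hb _)
    simp only [Finset.mem_Ico, Finset.mem_Icc] at hi ⊢
    omega
  have hmid0 : 0 ≤ ∑ i ∈ Finset.Ico N (n - N + 1), b i * φ (n - i) :=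
    Finset.sum_nonneg fun i _ => mul_nonneg (hb _) (hφ _)
  set S2 := (∑ i ∈ Finset.Ico N (n - N + 1), b i * φ (n - i)) / b n with hS2
  have hS2le : S2 ≤ ε / 8 := by rw [hS2, div_le_iff₀ hbn]; exact hmidle
  have hS20 : 0 ≤ S2 := div_nonneg hmid0 hbn.le
  have hone : 1 = ∑ i ∈ Finset.range N, b i * g (n - i) * (b (n - i) / b n) + S2 +
      ∑ i ∈ Finset.range N, φ i * (b (n - i) / b n) := by
    have e1 : ∑ i ∈ Finset.range N, b i * g (n - i) * (b (n - i) / b n) =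
        (∑ i ∈ Finset.range N, b i * φ (n - i)) / b n := by
      rw [Finset.sum_div]
      exact Finset.sum_congr rfl fun i _ => by rw [← hgb (n - i)]; ring
    have e3 : ∑ i ∈ Finset.range N, φ i * (b (n - i) / b n) =
        (∑ i ∈ Finset.range N, b (n - i) * φ (n - (n - i))) / b n := by
      rw [Finset.sum_div]
      refine Finset.sum_congr rfl fun i hi => ?_
      rw [Nat.sub_sub_self (by have := Finset.mem_range.mp hi; omega)]; ring
    rw [e1, e3, hS2, ← add_div, ← add_div, ← hR, div_self hbn.ne']
  have hmain : ∑ p ∈ antidiagonal n, b p.1 * g p.2 =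
      ∑ i ∈ Finset.range N, b i * g (n - i) + ∑ i ∈ Finset.Ico N (n + 1), b i * g (n - i) := by
    rw [Finset.Nat.sum_antidiagonal_eq_sum_range_succ_mk, Finset.range_eq_Ico,
      ← Finset.sum_Ico_consecutive _ (Nat.zero_le N) (by omega : N ≤ n + 1),
      Finset.range_eq_Ico]
  have hT0 : 0 ≤ ∑ i ∈ Finset.Ico N (n + 1), b i * g (n - i) :=
    Finset.sum_nonneg fun i _ => mul_nonneg (hb _) (hg0 _)
  have hT1 : ∑ i ∈ Finset.Ico N (n + 1), b i * g (n - i) ≤ ε / 8 :=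
    (Finset.sum_le_sum fun i _ => mul_le_of_le_one_right (hb i) (hg1 _)).trans (hbt _)
  have hD : |∑ i ∈ Finset.range N, b i * g (n - i) * (b (n - i) / b n) -
      ∑ i ∈ Finset.range N, b i * g (n - i)| < ε / 8 := by
    rw [← Finset.sum_sub_distrib]
    refine ((Finset.abs_sum_le_sum_abs _ _).trans (Finset.sum_le_sum fun i _ => ?_)).trans_lt h1
    rw [show b i * g (n - i) * (b (n - i) / b n) - b i * g (n - i) =
      b i * g (n - i) * (b (n - i) / b n - 1) by ring, abs_mul,
      abs_of_nonneg (mul_nonneg (hb i) (hg0 _))]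
    exact mul_le_mul_of_nonneg_right (mul_le_of_le_one_right (hb i) (hg1 _)) (abs_nonneg _)
  rw [Real.dist_eq] at h3 ⊢
  rw [hmain, hφt]
  rw [abs_lt] at *
  constructor <;> linarith [h3.1, h3.2, hD.1, hD.2]

/-- Deconvolution: `g = b * g - φ * (b * g)`, where `b * g` converges and Tannery's theorem handles
the second term. -/
theorem renewal_ratio_tendsto (hb : ∀ n, 0 ≤ b n) (hφ : ∀ n, 0 ≤ φ n) (hb0 : b 0 = 1)
    (hφ0 : φ 0 = 0) (hren : ∀ n, 1 ≤ n → b n = ∑ p ∈ antidiagonal n, φ p.1 * b p.2)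
    (hr : Tendsto (fun n => b (n + 1) / b n) atTop (𝓝 1)) (hsm : SmallMiddleSums b) :
    Tendsto (fun n => φ n / b n) atTop (𝓝 ((1 - ∑' n, φ n) ^ 2)) := by
  have hs := hsm.summable hb hr
  have hsφ : Summable φ := Summable.of_nonneg_of_le hφ (renewal_le hb hφ hb0 hφ0 hren) hs
  have h1 := tendsto_convolution_ratio hb hφ hb0 hφ0 hren hr hsm
  have h2 := h1.sub (tendsto_sum_antidiagonal_mul hφ hsφ h1)
  rw [show (1 - ∑' n, φ n) - (∑' n, φ n) * (1 - ∑' n, φ n) = (1 - ∑' n, φ n) ^ 2 by ring] at h2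
  exact h2.congr fun n => renewal_convolution_inverse hb0 hφ0 hren (fun n => φ n / b n) n

end Renewal

end SRW

namespace SRW

/-! ### Log-convex sequences -/

section LogConvex

variable {c : ℕ → ℝ}

theorem logConvex_pow_le (hc : ∀ k, 0 ≤ c k) (h0 : 0 < c 0)
    (hlc : ∀ k, c (k + 1) ^ 2 ≤ c k * c (k + 2)) (k : ℕ) :
    c 0 * (c 1 / c 0) ^ k ≤ c k := by
  -- If `c 1 = 0` the bound is trivial; otherwise log-convexity propagates positivity and the ratios
  -- are nondecreasing.
  rcases (hc 1).eq_or_lt with h1 | h1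
  · rcases Nat.eq_zero_or_pos k with rfl | hk
    · simp
    · rw [← h1, zero_div, zero_pow hk.ne', mul_zero]; exact hc k
  have hpos : ∀ k, 0 < c k ∧ 0 < c (k + 1) := by
    intro k
    induction k with
    | zero => exact ⟨h0, h1⟩
    | succ k ih =>
      refine ⟨ih.2, ?_⟩
      have := hlc k
      have h3 : 0 < c k * c (k + 2) := lt_of_lt_of_le (pow_pos ih.2 2) this
      exact pos_of_mul_pos_right h3 ih.1.le
  have hmono : Monotone fun k => c (k + 1) / c k := by
    refine monotone_nat_of_le_succ fun k => ?_
    rw [div_le_div_iff₀ (hpos k).1 (hpos k).2]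
    have := hlc k
    rw [show k + 1 + 1 = k + 2 from rfl]
    nlinarith
  induction k with
  | zero => simp
  | succ k ih =>
    have h2 : c 1 / c 0 ≤ c (k + 1) / c k := hmono (Nat.zero_le k)
    rw [le_div_iff₀ (hpos k).1] at h2
    rw [pow_succ, ← mul_assoc]
    calc c 0 * (c 1 / c 0) ^ k * (c 1 / c 0) ≤ c k * (c 1 / c 0) :=
          mul_le_mul_of_nonneg_right ih (div_nonneg h1.le h0.le)
      _ ≤ c (k + 1) := by linarith

/-- The successive ratios of a bounded log-convex sequence increase to their limit. -/
theorem logConvex_ratio_tendsto (hc : ∀ k, 0 < c k) (hc1 : ∀ k, c k ≤ 1) (h0 : c 0 = 1)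
    (hlc : ∀ k, c (k + 1) ^ 2 ≤ c k * c (k + 2)) :
    ∃ r : ℝ, 0 < r ∧ Tendsto (fun k => c (k + 1) / c k) atTop (𝓝 r) ∧
      (∀ k, c (k + 1) ≤ r * c k) ∧ ∀ k, c k ≤ r ^ k := by
  have hmono : Monotone fun k => c (k + 1) / c k := by
    refine monotone_nat_of_le_succ fun k => ?_
    rw [div_le_div_iff₀ (hc k) (hc _)]
    have := hlc k
    rw [show k + 1 + 1 = k + 2 from rfl]
    nlinarith
  -- A ratio above `1` would force geometric growth from there on, against `c ≤ 1`.
  have hle1 : ∀ k, c (k + 1) / c k ≤ 1 := by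
    intro j
    by_contra! hj
    have hgrow : ∀ i, c j * (c (j + 1) / c j) ^ i ≤ c (j + i) := by
      intro i
      have := logConvex_pow_le (c := fun i => c (j + i)) (fun k => (hc _).le) (hc _)
        (fun k => hlc (j + k)) i
      simpa using this
    obtain ⟨i, hi⟩ := ((tendsto_pow_atTop_atTop_of_one_lt hj).const_mul_atTop
      (hc j)).eventually_gt_atTop 1 |>.exists
    linarith [hgrow i, hc1 (j + i)]
  have hbdd : BddAbove (Set.range fun k => c (k + 1) / c k) :=
    ⟨1, by rintro _ ⟨k, rfl⟩; exact hle1 k⟩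
  have hlim := tendsto_atTop_ciSup hmono hbdd
  set r := ⨆ k, c (k + 1) / c k
  have hr : ∀ k, c (k + 1) ≤ r * c k := by
    intro k
    rw [← div_le_iff₀ (hc k)]
    exact le_ciSup hbdd k
  have hrpos : 0 < r := lt_of_lt_of_le (div_pos (hc 1) (hc 0)) (le_ciSup hbdd 0)
  refine ⟨r, hrpos, hlim, hr, fun k => ?_⟩
  induction k with
  | zero => simp [h0]
  | succ k ih =>
    rw [pow_succ, mul_comm]
    exact (hr k).trans (mul_le_mul_of_nonneg_left ih hrpos.le)

theorem le_of_eventually_mul_pow_le {A B p r : ℝ} (hA : 0 < A) (hr : 0 < r)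
    (h : ∀ᶠ i : ℕ in atTop, A * p ^ i ≤ B * r ^ i) : p ≤ r := by
  by_contra! hlt
  have h1 := (tendsto_pow_atTop_atTop_of_one_lt ((one_lt_div hr).mpr hlt)).eventually_gt_atTop
    (B / A)
  obtain ⟨i, hi, hi'⟩ := (h.and h1).exists
  rw [div_pow, div_lt_div_iff₀ hA (pow_pos hr i)] at hi'
  linarith

end LogConvex

theorem tendsto_of_even_odd {α : Type*} {v : ℕ → α} {l : Filter α}
    (he : Tendsto (fun k => v (2 * k)) atTop l) (ho : Tendsto (fun k => v (2 * k + 1)) atTop l) :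
    Tendsto v atTop l := by
  intro s hs
  obtain ⟨A, hA⟩ := eventually_atTop.mp (he hs)
  obtain ⟨B, hB⟩ := eventually_atTop.mp (ho hs)
  refine eventually_atTop.mpr ⟨2 * A + 2 * B, fun n hn => ?_⟩
  obtain ⟨k, rfl | rfl⟩ := Nat.even_or_odd' n
  · exact hA k (by omega)
  · exact hB k (by omega)

/-! ### Ratio limits for the moments of a return functional -/

open Polynomial in
/-- The properties of the sequence of moments `ℓ (X ^ n)` of a transitive reversible Markov
operator at a vertex which determine its ratio asymptotics. -/
structure IsReturnFunctional (ℓ : ℝ[X] →ₗ[ℝ] ℝ) : Prop where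
  mul_self_nonneg : ∀ p, 0 ≤ ℓ (p * p)
  sub_pow_mul_nonneg : ∀ m j k : ℕ, 0 ≤ ℓ ((X ^ m - C (ℓ (X ^ m))) ^ j * X ^ k)
  one : ℓ 1 = 1
  le_one : ∀ n : ℕ, ℓ (X ^ n) ≤ 1
  two_pos : 0 < ℓ (X ^ 2)

namespace IsReturnFunctional

open Polynomial

variable {ℓ : ℝ[X] →ₗ[ℝ] ℝ} (hℓ : IsReturnFunctional ℓ)

include hℓ

theorem nonneg (n : ℕ) : 0 ≤ ℓ (X ^ n) := by
  simpa using hℓ.sub_pow_mul_nonneg 0 0 n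

theorem cauchy_schwarz (p q : ℝ[X]) : ℓ (p * q) ^ 2 ≤ ℓ (p * p) * ℓ (q * q) := by
  have h : ∀ t : ℝ, 0 ≤ ℓ (p * p) * (t * t) + 2 * ℓ (p * q) * t + ℓ (q * q) := by
    intro t
    have h1 := hℓ.mul_self_nonneg (t • p + q)
    have h2 : (t • p + q) * (t • p + q) =
        (t * t) • (p * p) + (2 * t) • (p * q) + q * q := by
      simp only [smul_eq_C_mul, C_mul, map_ofNat]; ring
    rw [h2, map_add, map_add, map_smul, map_smul, smul_eq_mul, smul_eq_mul] at h1
    linarith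
  have := discrim_le_zero h
  rw [discrim] at this
  nlinarith

theorem sq_le (i j : ℕ) : ℓ (X ^ (i + j)) ^ 2 ≤ ℓ (X ^ (2 * i)) * ℓ (X ^ (2 * j)) := by
  have := hℓ.cauchy_schwarz (X ^ i) (X ^ j)
  rwa [← pow_add, ← pow_add, ← pow_add, ← two_mul, ← two_mul] at this

theorem even_logConvex (k : ℕ) :
    ℓ (X ^ (2 * (k + 1))) ^ 2 ≤ ℓ (X ^ (2 * k)) * ℓ (X ^ (2 * (k + 2))) := by
  have := hℓ.sq_le k (k + 2)
  rwa [show k + (k + 2) = 2 * (k + 1) by ring] at this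

theorem two_pow_le (k : ℕ) : ℓ (X ^ 2) ^ k ≤ ℓ (X ^ (2 * k)) := by
  have := logConvex_pow_le (c := fun k => ℓ (X ^ (2 * k))) (fun k => hℓ.nonneg _)
    (by simp [hℓ.one]) hℓ.even_logConvex k
  simpa [hℓ.one] using this

theorem even_pos (k : ℕ) : 0 < ℓ (X ^ (2 * k)) :=
  lt_of_lt_of_le (pow_pos hℓ.two_pos k) (hℓ.two_pow_le k)

theorem exists_radius : ∃ σ : ℝ, 0 < σ ∧
    Tendsto (fun k : ℕ => ℓ (X ^ (2 * (k + 1))) / ℓ (X ^ (2 * k))) atTop (𝓝 (σ ^ 2)) ∧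
    ∀ n : ℕ, ℓ (X ^ n) ≤ σ ^ n := by
  obtain ⟨r, hr, hlim, hstep, hle⟩ := logConvex_ratio_tendsto
    (c := fun k => ℓ (X ^ (2 * k))) hℓ.even_pos (fun k => hℓ.le_one _) (by simp [hℓ.one])
    hℓ.even_logConvex
  have hsq : Real.sqrt r ^ 2 = r := Real.sq_sqrt hr.le
  have hs0 : 0 < Real.sqrt r := Real.sqrt_pos.mpr hr
  refine ⟨Real.sqrt r, hs0, by rwa [hsq], fun n => ?_⟩
  have heven : ∀ k, ℓ (X ^ (2 * k)) ≤ Real.sqrt r ^ (2 * k) := by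
    intro k; rw [pow_mul √r, hsq]; exact hle k
  have h1 := hℓ.sq_le 0 n
  rw [zero_add, mul_zero, pow_zero, hℓ.one, one_mul] at h1
  refine (sq_le_sq₀ (hℓ.nonneg n) (pow_nonneg hs0.le n)).mp (h1.trans ?_)
  rw [← pow_mul, mul_comm n 2]
  exact heven n

/-- Were the limsup below some `r < σ`, then `ℓ (X ^ n) ≤ r ^ n` eventually; but some even ratio
exceeds `r ^ 2`, and log-convexity keeps the growth at that rate. -/
theorem limsup_eq {σ : ℝ} (hσ : 0 < σ)
    (hlim : Tendsto (fun k : ℕ => ℓ (X ^ (2 * (k + 1))) / ℓ (X ^ (2 * k))) atTop (𝓝 (σ ^ 2)))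
    (hle : ∀ n : ℕ, ℓ (X ^ n) ≤ σ ^ n) :
    limsup (fun n : ℕ => ℓ (X ^ n) ^ (1 / (n : ℝ))) atTop = σ := by
  have hup : ∀ᶠ n : ℕ in atTop, ℓ (X ^ n) ^ (1 / (n : ℝ)) ≤ σ := by
    filter_upwards [eventually_ge_atTop 1] with n hn
    calc ℓ (X ^ n) ^ (1 / (n : ℝ)) ≤ (σ ^ n) ^ (1 / (n : ℝ)) :=
          Real.rpow_le_rpow (hℓ.nonneg n) (hle n) (by positivity)
      _ = σ := by rw [one_div, Real.pow_rpow_inv_natCast hσ.le (by omega)]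
  have hnn : ∀ n : ℕ, 0 ≤ ℓ (X ^ n) ^ (1 / (n : ℝ)) := fun n =>
    Real.rpow_nonneg (hℓ.nonneg n) _
  have hbdd : IsBoundedUnder (· ≤ ·) atTop fun n : ℕ => ℓ (X ^ n) ^ (1 / (n : ℝ)) :=
    ⟨σ, by simpa using hup⟩
  have hcob : IsCoboundedUnder (· ≤ ·) atTop fun n : ℕ => ℓ (X ^ n) ^ (1 / (n : ℝ)) :=
    IsCoboundedUnder.of_frequently_ge (a := 0) (Frequently.of_forall hnn)
  refine le_antisymm (limsup_le_of_le hcob hup) ?_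
  by_contra! hlt
  obtain ⟨r, hr1, hr2⟩ := exists_between (max_lt hlt hσ)
  have hr0 : 0 < r := (le_max_right _ _).trans_lt hr1
  have hur : ∀ᶠ n : ℕ in atTop, ℓ (X ^ n) ≤ r ^ n := by
    filter_upwards [eventually_lt_of_limsup_lt ((le_max_left _ _).trans_lt hr1) hbdd,
      eventually_ge_atTop 1] with n hn hn1
    have := pow_le_pow_left₀ (hnn n) hn.le n
    rwa [one_div, Real.rpow_inv_natCast_pow (hℓ.nonneg n) (by omega)] at this
  obtain ⟨K, hK⟩ := (hlim.eventually_const_lt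
    (pow_lt_pow_left₀ hr2 hr0.le two_ne_zero)).exists
  refine hK.not_ge (le_of_eventually_mul_pow_le (A := ℓ (X ^ (2 * K))) (B := r ^ (2 * K))
    (hℓ.even_pos K) (by positivity) ?_)
  have hmap : Tendsto (fun i => 2 * (K + i)) atTop atTop :=
    tendsto_atTop_mono (fun i => by dsimp only [id]; omega) tendsto_id
  filter_upwards [hmap.eventually hur] with i hi
  have h1 := logConvex_pow_le (c := fun i => ℓ (X ^ (2 * (K + i)))) (fun k => hℓ.nonneg _)
    (hℓ.even_pos _) (fun k => hℓ.even_logConvex (K + k)) i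
  refine h1.trans (hi.trans_eq ?_)
  rw [← pow_mul, ← pow_add, mul_add]

/-- The operator norm bound for the nonnegative kernel `P ^ m - u_m` restricted to the cyclic
subspace of the vertex. -/
theorem sub_sq_mul_le {σ : ℝ} (hσ : 0 < σ) (hle : ∀ n : ℕ, ℓ (X ^ n) ≤ σ ^ n) {m : ℕ}
    (hm : 0 < ℓ (X ^ m)) (n : ℕ) :
    ℓ ((X ^ m - C (ℓ (X ^ m))) ^ 2 * X ^ (2 * n)) ≤
      (σ ^ m - ℓ (X ^ m)) ^ 2 * ℓ (X ^ (2 * n)) := by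
  set ε := ℓ (X ^ m) with hε
  set R : ℝ[X] := X ^ m - C ε with hR
  -- These are the moments of `R` at the vector `X ^ n`. The even ones are log-convex, so they grow
  -- at least like `q ^ (2k)` with `q ^ 2 = e 2 / e 0`; it remains to show `q ≤ σ ^ m - ε`.
  set e : ℕ → ℝ := fun j => ℓ (R ^ j * X ^ (2 * n)) with he
  have he0 : ∀ j, 0 ≤ e j := fun j => hℓ.sub_pow_mul_nonneg m j (2 * n)
  have hpos : 0 < e 0 := by simpa [he] using hℓ.even_pos n
  have hlc : ∀ k, e (2 * (k + 1)) ^ 2 ≤ e (2 * k) * e (2 * (k + 2)) := by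
    intro k
    have := hℓ.cauchy_schwarz (R ^ k * X ^ n) (R ^ (k + 2) * X ^ n)
    simp only [he]
    convert this using 3 <;> ring
  set q := Real.sqrt (e 2 / e 0) with hq
  have hq0 : 0 ≤ q := Real.sqrt_nonneg _
  have hq2 : q ^ 2 = e 2 / e 0 := Real.sq_sqrt (div_nonneg (he0 2) hpos.le)
  have hgrow : ∀ k, e 0 * q ^ (2 * k) ≤ e (2 * k) := by
    intro k
    rw [pow_mul, hq2]
    exact logConvex_pow_le (c := fun k => e (2 * k)) (fun k => he0 _) hpos hlc k
  -- About odd `e j` only nonnegativity is known; symmetrizing in `q` makes the lower bound vanish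
  -- there.
  have hgrow' : ∀ j, e 0 / 2 * (q ^ j + (-q) ^ j) ≤ e j := by
    intro j
    rcases Nat.even_or_odd j with hj | hj
    · obtain ⟨k, rfl⟩ := even_iff_two_dvd.mp hj
      rw [hj.neg_pow]
      linarith [hgrow k]
    · rw [hj.neg_pow, add_neg_cancel, mul_zero]
      exact he0 j
  have hbin : ∀ K, ℓ (X ^ (m * K + 2 * n)) =
      ∑ j ∈ Finset.range (K + 1), ε ^ (K - j) * (K.choose j) * e j := by
    intro K
    have h1 : (X : ℝ[X]) ^ (m * K + 2 * n) = (R + C ε) ^ K * X ^ (2 * n) := by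
      rw [hR, sub_add_cancel, pow_add, pow_mul]
    rw [h1, add_pow, Finset.sum_mul, map_sum]
    refine Finset.sum_congr rfl fun j _ => ?_
    have h2 : R ^ j * C ε ^ (K - j) * (K.choose j : ℝ[X]) * X ^ (2 * n) =
        (ε ^ (K - j) * (K.choose j)) • (R ^ j * X ^ (2 * n)) := by
      rw [smul_eq_C_mul, C_mul, C_pow, map_natCast]; ring
    rw [h2, map_smul, smul_eq_mul]
  have hlow : ∀ K, e 0 / 2 * ((q + ε) ^ K + (-q + ε) ^ K) ≤ ℓ (X ^ (m * K + 2 * n)) := by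
    intro K
    rw [hbin, add_pow, add_pow, ← Finset.sum_add_distrib, Finset.mul_sum]
    refine Finset.sum_le_sum fun j _ => ?_
    calc _ = ε ^ (K - j) * (K.choose j) * (e 0 / 2 * (q ^ j + (-q) ^ j)) := by ring
      _ ≤ _ := mul_le_mul_of_nonneg_left (hgrow' j) (by positivity)
  -- Compare exponential rates. Even exponents `2 * K` make the `(-q + ε)` term nonnegative, so it
  -- can be dropped.
  have hqσ : (q + ε) ^ 2 ≤ (σ ^ m) ^ 2 := by
    refine le_of_eventually_mul_pow_le (A := e 0 / 2) (B := σ ^ (2 * n)) (by positivity)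
      (by positivity) (Eventually.of_forall fun K => ?_)
    have h1 := (hlow (2 * K)).trans (hle _)
    have h2 : 0 ≤ e 0 / 2 * (-q + ε) ^ (2 * K) :=
      mul_nonneg (by positivity) (Even.pow_nonneg (even_two_mul K) _)
    have h3 : σ ^ (m * (2 * K) + 2 * n) = σ ^ (2 * n) * ((σ ^ m) ^ 2) ^ K := by ring
    rw [h3, mul_add] at h1
    rw [← pow_mul]
    linarith
  have hqs : q ≤ σ ^ m - ε := by
    have := (sq_le_sq₀ (by positivity) (by positivity)).mp hqσ
    linarith
  have h5 : q ^ 2 ≤ (σ ^ m - ε) ^ 2 := pow_le_pow_left₀ hq0 hqs 2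
  rw [hq2, div_le_iff₀ hpos] at h5
  simpa [he] using h5

/-- A squeeze: Cauchy–Schwarz bounds the ratio above by `√(u_{2k+2m} / u_{2k})`, and expanding the
square in `sub_sq_mul_le` bounds it below; both bounds tend to `σ ^ m`. -/
theorem odd_ratio_tendsto {σ : ℝ} (hσ : 0 < σ)
    (hlim : Tendsto (fun k : ℕ => ℓ (X ^ (2 * (k + 1))) / ℓ (X ^ (2 * k))) atTop (𝓝 (σ ^ 2)))
    (hle : ∀ n : ℕ, ℓ (X ^ n) ≤ σ ^ n) {m : ℕ} (hm : 0 < ℓ (X ^ m)) :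
    Tendsto (fun k : ℕ => ℓ (X ^ (2 * k + m)) / ℓ (X ^ (2 * k))) atTop (𝓝 (σ ^ m)) := by
  have hshift : ∀ i : ℕ, Tendsto (fun k : ℕ => ℓ (X ^ (2 * k + 2 * i)) / ℓ (X ^ (2 * k))) atTop
      (𝓝 ((σ ^ i) ^ 2)) := by
    intro i
    induction i with
    | zero =>
      simp only [mul_zero, add_zero, pow_zero, one_pow]
      exact tendsto_const_nhds.congr fun k => (div_self (hℓ.even_pos k).ne').symm
    | succ i ih =>
      have h1 := (hlim.comp (tendsto_add_atTop_nat i)).mul ih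
      rw [show σ ^ 2 * (σ ^ i) ^ 2 = (σ ^ (i + 1)) ^ 2 by ring] at h1
      refine h1.congr fun k => ?_
      simp only [Function.comp]
      rw [show 2 * k + 2 * i = 2 * (k + i) by ring,
        div_mul_div_cancel₀ (hℓ.even_pos _).ne']
      rw [show 2 * (k + i + 1) = 2 * k + 2 * (i + 1) by ring]
  set ε := ℓ (X ^ m) with hε
  have hlow : ∀ k : ℕ, (ℓ (X ^ (2 * k + 2 * m)) / ℓ (X ^ (2 * k)) -
      (σ ^ m) ^ 2 + 2 * ε * σ ^ m) / (2 * ε) ≤ ℓ (X ^ (2 * k + m)) / ℓ (X ^ (2 * k)) := by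
    intro k
    have h1 := hℓ.sub_sq_mul_le hσ hle hm k
    rw [← hε] at h1
    have h2 : (X ^ m - C ε) ^ 2 * X ^ (2 * k) = (X : ℝ[X]) ^ (2 * k + 2 * m) -
        (2 * ε) • X ^ (2 * k + m) + (ε ^ 2) • X ^ (2 * k) := by
      simp only [smul_eq_C_mul, C_mul, C_pow, map_ofNat]; ring
    rw [h2, map_add, map_sub, map_smul, map_smul, smul_eq_mul, smul_eq_mul] at h1
    have hp := hℓ.even_pos k
    rw [div_le_iff₀ (by positivity), ← sub_nonneg]
    have : ℓ (X ^ (2 * k + m)) / ℓ (X ^ (2 * k)) * (2 * ε) -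
        (ℓ (X ^ (2 * k + 2 * m)) / ℓ (X ^ (2 * k)) - (σ ^ m) ^ 2 + 2 * ε * σ ^ m) =
        (2 * ε * ℓ (X ^ (2 * k + m)) - ℓ (X ^ (2 * k + 2 * m)) +
          ((σ ^ m) ^ 2 - 2 * ε * σ ^ m) * ℓ (X ^ (2 * k))) / ℓ (X ^ (2 * k)) := by
      field_simp
      ring
    rw [this]
    refine div_nonneg ?_ hp.le
    nlinarith
  have hupp : ∀ k : ℕ, ℓ (X ^ (2 * k + m)) / ℓ (X ^ (2 * k)) ≤
      Real.sqrt (ℓ (X ^ (2 * k + 2 * m)) / ℓ (X ^ (2 * k))) := by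
    intro k
    refine Real.le_sqrt_of_sq_le ?_
    have hp := hℓ.even_pos k
    have h1 := hℓ.sq_le k (k + m)
    rw [show k + (k + m) = 2 * k + m by ring, show 2 * (k + m) = 2 * k + 2 * m by ring] at h1
    rw [div_pow, div_le_div_iff₀ (by positivity) hp]
    nlinarith
  have hL : Tendsto (fun k : ℕ => (ℓ (X ^ (2 * k + 2 * m)) / ℓ (X ^ (2 * k)) -
      (σ ^ m) ^ 2 + 2 * ε * σ ^ m) / (2 * ε)) atTop (𝓝 (σ ^ m)) := by
    have := (((hshift m).sub_const ((σ ^ m) ^ 2)).add_const (2 * ε * σ ^ m)).div_const (2 * ε)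
    rwa [sub_self, zero_add, mul_div_cancel_left₀ _ (by positivity)] at this
  have hU := (hshift m).sqrt
  rw [Real.sqrt_sq (by positivity)] at hU
  exact tendsto_of_tendsto_of_tendsto_of_le_of_le hL hU hlow hupp

/-- The normalized moments have ratio limit one in the aperiodic case. -/
theorem normalized_ratio_tendsto {σ : ℝ} (hσ : 0 < σ)
    (hlim : Tendsto (fun k : ℕ => ℓ (X ^ (2 * (k + 1))) / ℓ (X ^ (2 * k))) atTop (𝓝 (σ ^ 2)))
    (hle : ∀ n : ℕ, ℓ (X ^ n) ≤ σ ^ n) {j : ℕ} (hm : 0 < ℓ (X ^ (2 * j + 1))) :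
    Tendsto (fun n : ℕ => (ℓ (X ^ (n + 1)) / σ ^ (n + 1)) / (ℓ (X ^ n) / σ ^ n)) atTop
      (𝓝 1) := by
  set a : ℕ → ℝ := fun n => ℓ (X ^ n) / σ ^ n with ha
  have hane : ∀ k, a (2 * k) ≠ 0 := fun k => (div_pos (hℓ.even_pos k) (pow_pos hσ _)).ne'
  have hdiv : ∀ n i, a (n + i) / a n = ℓ (X ^ (n + i)) / ℓ (X ^ n) / σ ^ i := by
    intro n i
    simp only [ha]
    rw [pow_add σ]
    field_simp
  have h2 : Tendsto (fun k => a (2 * (k + 1)) / a (2 * k)) atTop (𝓝 1) := by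
    have := hlim.div_const (σ ^ 2)
    rw [div_self (by positivity)] at this
    exact this.congr fun k => (hdiv (2 * k) 2).symm
  have hodd : Tendsto (fun k => a (2 * k + (2 * j + 1)) / a (2 * k)) atTop (𝓝 1) := by
    have := (hℓ.odd_ratio_tendsto hσ hlim hle hm).div_const (σ ^ (2 * j + 1))
    rw [div_self (by positivity)] at this
    exact this.congr fun k => (hdiv (2 * k) (2 * j + 1)).symm
  have hsh := tendsto_shift_div (b := fun k => a (2 * k)) h2 j
  have h1 : Tendsto (fun k => a (2 * k + 1) / a (2 * k)) atTop (𝓝 1) := by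
    -- A jump by `2 * j + 1` from `2 * k` divided by a jump by `2 * j` is a single step from `2 * (k
    -- + j)`.
    rw [← tendsto_add_atTop_iff_nat j]
    have := hodd.div hsh one_ne_zero
    rw [div_one] at this
    refine this.congr fun k => ?_
    simp only [Pi.div_apply]
    rw [div_div_div_cancel_right₀ (hane k), show 2 * k + (2 * j + 1) = 2 * (k + j) + 1 by ring]
  have h3 : Tendsto (fun k => a (2 * k + 2) / a (2 * k + 1)) atTop (𝓝 1) := by
    have := h2.div h1 one_ne_zero
    rw [div_one] at this
    exact this.congr fun k => div_div_div_cancel_right₀ (hane k) _ _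
  exact tendsto_of_even_odd h1 h3

end IsReturnFunctional

end SRW

namespace SRW

open Finset.HasAntidiagonal (antidiagonal)

noncomputable section

/-! ### The transition operator of a regular graph -/

section Operator

variable {V : Type*} (G : SimpleGraph V) [G.LocallyFinite]

/-- The transition operator of simple random walk on a `d`-regular graph, acting on finitely
supported functions. -/
def walkOp (d : ℕ) : Module.End ℝ (V →₀ ℝ) :=
  Finsupp.linearCombination ℝ fun y =>
    (d : ℝ)⁻¹ • ∑ w ∈ G.neighborFinset y, Finsupp.single w (1 : ℝ)

variable {G} {d : ℕ}

/-- Adjacency is symmetric and the weight `d⁻¹` constant, so spreading mass forward equals averaging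
over neighbours. -/
theorem walkOp_apply (f : V →₀ ℝ) (z : V) :
    walkOp G d f z = (d : ℝ)⁻¹ * ∑ w ∈ G.neighborFinset z, f w := by
  classical
  induction f using Finsupp.induction_linear with
  | zero => simp
  | add f g hf hg => simp [hf, hg, Finset.sum_add_distrib, mul_add]
  | single y c =>
    simp [walkOp, Finsupp.single_apply, Finset.sum_ite_eq',
      Finset.sum_ite_eq, G.adj_comm y z, mul_comm c]

theorem walkOp_nonneg {f : V →₀ ℝ} (hf : ∀ y, 0 ≤ f y) (z : V) : 0 ≤ walkOp G d f z := by
  rw [walkOp_apply]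
  exact mul_nonneg (by positivity) (Finset.sum_nonneg fun w _ => hf w)

theorem walkOp_pow_nonneg {f : V →₀ ℝ} (hf : ∀ y, 0 ≤ f y) (n : ℕ) (z : V) :
    0 ≤ (walkOp G d ^ n) f z := by
  induction n generalizing z with
  | zero => simpa using hf z
  | succ n ih =>
    rw [pow_succ', Module.End.mul_apply]
    exact walkOp_nonneg ih z

theorem walkOp_pos {f : V →₀ ℝ} (hd : 0 < d) (hf : ∀ y, 0 ≤ f y) {y z : V} (hyz : G.Adj y z)
    (hy : 0 < f y) : 0 < walkOp G d f z := by
  rw [walkOp_apply]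
  refine mul_pos (by positivity) (Finset.sum_pos' (fun w _ => hf w) ⟨y, ?_, hy⟩)
  simpa using hyz.symm

theorem exists_adj_of_walkOp_pos {f : V →₀ ℝ} {z : V} (h : 0 < walkOp G d f z) :
    ∃ y, G.Adj y z ∧ 0 < f y := by
  rw [walkOp_apply] at h
  have h1 : 0 < ∑ w ∈ G.neighborFinset z, f w := pos_of_mul_pos_right h (by positivity)
  obtain ⟨y, hy, hpos⟩ := Finset.exists_lt_of_sum_lt (s := G.neighborFinset z)
    (f := fun _ => (0 : ℝ)) (g := f) (by simpa using h1)
  exact ⟨y, by simpa [G.adj_comm] using hy, hpos⟩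

theorem single_one_nonneg (x y : V) : 0 ≤ Finsupp.single x (1 : ℝ) y := by
  classical
  rw [Finsupp.single_apply]; split_ifs <;> norm_num

theorem walkOp_pow_le_one (hd : ∀ y, G.degree y = d) (x : V) (n : ℕ) (z : V) :
    (walkOp G d ^ n) (Finsupp.single x 1) z ≤ 1 := by
  classical
  induction n generalizing z with
  | zero =>
    simp only [pow_zero, Module.End.one_apply, Finsupp.single_apply]
    split_ifs <;> norm_num
  | succ n ih =>
    rw [pow_succ', Module.End.mul_apply, walkOp_apply]
    have h1 : ∑ w ∈ G.neighborFinset z, (walkOp G d ^ n) (Finsupp.single x 1) w ≤ d := by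
      refine (Finset.sum_le_card_nsmul _ _ 1 fun w _ => ih w).trans ?_
      simp [hd z]
    exact inv_mul_le_one_of_le₀ h1 (by positivity)

theorem walkOp_pow_automorphism (φ : G ≃g G) (y z : V) (n : ℕ) :
    (walkOp G d ^ n) (Finsupp.single (φ y) 1) (φ z) =
      (walkOp G d ^ n) (Finsupp.single y 1) z := by
  classical
  induction n generalizing z with
  | zero => simp [Finsupp.single_apply]
  | succ n ih =>
    rw [pow_succ', Module.End.mul_apply, Module.End.mul_apply, walkOp_apply, walkOp_apply]
    congr 1
    refine (Finset.sum_bij (fun w _ => φ w) ?_ ?_ ?_ ?_).symm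
    · intro w hw; simpa [φ.map_adj_iff] using hw
    · intro a _ b _ h; exact φ.injective h
    · intro b hb
      refine ⟨φ.symm b, ?_, by simp⟩
      rw [SimpleGraph.mem_neighborFinset] at hb ⊢
      rwa [← φ.map_adj_iff, φ.apply_symm_apply]
    · intro w _; exact (ih w).symm

/-- The standard pairing of finitely supported functions. -/
def pairing : (V →₀ ℝ) →ₗ[ℝ] (V →₀ ℝ) →ₗ[ℝ] ℝ :=
  Finsupp.lsum ℝ fun y => LinearMap.toSpanSingleton ℝ _ (Finsupp.lapply y)

theorem pairing_single_left (y : V) (c : ℝ) (g : V →₀ ℝ) :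
    pairing (Finsupp.single y c) g = c * g y := by
  simp [pairing]

theorem pairing_single_right (f : V →₀ ℝ) (y : V) (c : ℝ) :
    pairing f (Finsupp.single y c) = f y * c := by
  classical
  induction f using Finsupp.induction_linear with
  | zero => simp
  | add f g hf hg => simp [hf, hg, add_mul]
  | single z b =>
    rw [pairing_single_left, Finsupp.single_apply, Finsupp.single_apply]
    rcases eq_or_ne z y with rfl | h
    · simp
    · simp [h, h.symm]

theorem pairing_self_nonneg (f : V →₀ ℝ) : 0 ≤ pairing f f := by
  have : pairing f f = f.sum fun y c => c * f y := by
    simp [pairing, Finsupp.lsum_apply, Finsupp.sum, LinearMap.sum_apply]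
  rw [this]
  exact Finset.sum_nonneg fun y _ => mul_self_nonneg _

theorem pairing_walkOp (f g : V →₀ ℝ) :
    pairing (walkOp G d f) g = pairing f (walkOp G d g) := by
  classical
  induction f using Finsupp.induction_linear with
  | zero => simp
  | add f f' hf hf' => simp [hf, hf']
  | single y b =>
    induction g using Finsupp.induction_linear with
    | zero => simp
    | add g g' hg hg' => simp [hg, hg']
    | single z c =>
      rw [pairing_single_left, pairing_single_right, walkOp_apply, walkOp_apply]
      simp [Finsupp.single_apply, Finset.sum_ite_eq, G.adj_comm y z]
      split_ifs <;> ring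

theorem pairing_aeval_walkOp (p : Polynomial ℝ) (f g : V →₀ ℝ) :
    pairing (Polynomial.aeval (walkOp G d) p f) g =
      pairing f (Polynomial.aeval (walkOp G d) p g) := by
  induction p using Polynomial.induction_on' with
  | add p q hp hq => simp [hp, hq]
  | monomial n a =>
    rw [Polynomial.aeval_monomial]
    simp only [Module.End.mul_apply, Module.algebraMap_end_apply, map_smul, LinearMap.smul_apply]
    congr 1
    induction n generalizing f with
    | zero => simp
    | succ n ih =>
      rw [pow_succ, Module.End.mul_apply, ih, pairing_walkOp, ← Module.End.mul_apply,
        ← pow_succ', pow_succ]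

/-- The functional `p ↦ p(P)(x, x)` on polynomials, where `P` is the transition operator. -/
def returnFunctional (G : SimpleGraph V) [G.LocallyFinite] (d : ℕ) (x : V) :
    Polynomial ℝ →ₗ[ℝ] ℝ :=
  Finsupp.lapply x ∘ₗ LinearMap.applyₗ (Finsupp.single x (1 : ℝ)) ∘ₗ
    (Polynomial.aeval (walkOp G d)).toLinearMap

theorem returnFunctional_apply (x : V) (p : Polynomial ℝ) :
    returnFunctional G d x p = Polynomial.aeval (walkOp G d) p (Finsupp.single x 1) x := rfl

theorem returnFunctional_X_pow (x : V) (n : ℕ) :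
    returnFunctional G d x (Polynomial.X ^ n) =
      (walkOp G d ^ n) (Finsupp.single x 1) x := by
  simp [returnFunctional_apply]

/-- Self-adjointness turns `ℓ (p * p)` into the squared norm of `p(P) δ_x`. Transitivity makes the
diagonal of `P ^ m` constant, so subtracting that constant leaves an operator preserving nonnegative
functions. -/
theorem isReturnFunctional (htrans : IsTransitive G) (hd : ∀ y, G.degree y = d) (hd0 : 0 < d)
    (x : V) : IsReturnFunctional (returnFunctional G d x) where
  mul_self_nonneg p := by
    rw [returnFunctional_apply, map_mul, Module.End.mul_apply]
    have h1 := pairing_single_left x 1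
      (Polynomial.aeval (walkOp G d) p (Polynomial.aeval (walkOp G d) p (Finsupp.single x 1)))
    rw [one_mul] at h1
    rw [← h1, ← pairing_aeval_walkOp]
    exact pairing_self_nonneg _
  sub_pow_mul_nonneg m j k := by
    set ε := returnFunctional G d x (Polynomial.X ^ m) with hε
    have hdiag : ∀ y, (walkOp G d ^ m) (Finsupp.single y 1) y = ε := by
      intro y
      obtain ⟨φ, rfl⟩ := htrans x y
      rw [walkOp_pow_automorphism, hε, returnFunctional_X_pow]
    have hstep : ∀ f : V →₀ ℝ, (∀ y, 0 ≤ f y) →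
        ∀ z, 0 ≤ (Polynomial.aeval (walkOp G d) (Polynomial.X ^ m - Polynomial.C ε)) f z := by
      intro f hf z
      have h1 : (walkOp G d ^ m) f z = f z * ε + (walkOp G d ^ m) (f.erase z) z := by
        conv_lhs => rw [← Finsupp.single_add_erase z f]
        rw [map_add, Finsupp.add_apply, ← hdiag z]
        congr 1
        rw [show Finsupp.single z (f z) = f z • Finsupp.single z (1 : ℝ) by simp, map_smul]
        simp
      have h2 : 0 ≤ (walkOp G d ^ m) (f.erase z) z := by
        classical
        refine walkOp_pow_nonneg (fun y => ?_) m z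
        rw [Finsupp.erase_apply]
        split_ifs
        exacts [le_rfl, hf y]
      simp only [map_sub, map_pow, Polynomial.aeval_X, Polynomial.aeval_C,
        LinearMap.sub_apply, Module.algebraMap_end_apply, Finsupp.sub_apply, Finsupp.smul_apply,
        smul_eq_mul]
      linarith
    rw [returnFunctional_apply, map_mul, Module.End.mul_apply, map_pow]
    have hk : ∀ y : V, 0 ≤ Polynomial.aeval (walkOp G d) (Polynomial.X ^ k : Polynomial ℝ)
        (Finsupp.single x 1) y := by
      intro y
      rw [map_pow, Polynomial.aeval_X]
      exact walkOp_pow_nonneg (single_one_nonneg x) k y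
    generalize Polynomial.aeval (walkOp G d) (Polynomial.X ^ k : Polynomial ℝ) (Finsupp.single x 1) = f at hk
    have : ∀ z, 0 ≤ (Polynomial.aeval (walkOp G d)
        (Polynomial.X ^ m - Polynomial.C ε) ^ j) f z := by
      induction j with
      | zero => simpa using hk
      | succ j ih =>
        intro z
        rw [pow_succ', Module.End.mul_apply]
        exact hstep _ ih z
    exact this x
  one := by simp [returnFunctional_apply]
  le_one n := by
    rw [returnFunctional_X_pow]
    exact walkOp_pow_le_one hd x n x
  two_pos := by
    rw [returnFunctional_X_pow, pow_two, Module.End.mul_apply]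
    have h0 : 0 < Finsupp.single x (1 : ℝ) x := by simp
    obtain ⟨y, hy⟩ := (G.degree_pos_iff_exists_adj x).mp (by rw [hd]; exact hd0)
    refine walkOp_pos hd0 (walkOp_nonneg (single_one_nonneg x)) hy.symm
      (walkOp_pos hd0 (single_one_nonneg x) hy h0)

theorem returnFunctional_two (hd : ∀ y, G.degree y = d) (hd0 : 0 < d) (x : V) :
    returnFunctional G d x (Polynomial.X ^ 2) = (d : ℝ)⁻¹ := by
  classical
  rw [returnFunctional_X_pow, pow_two, Module.End.mul_apply, walkOp_apply]
  have : ∀ w ∈ G.neighborFinset x, walkOp G d (Finsupp.single x 1) w = (d : ℝ)⁻¹ := by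
    intro w hw
    have hw' : G.Adj w x := by simpa [G.adj_comm] using hw
    rw [walkOp_apply]
    simp [Finsupp.single_apply, hw']
  rw [Finset.sum_congr rfl this]
  have hd' : (d : ℝ) ≠ 0 := by positivity
  simp [hd x, hd']

/-! ### First returns: renewal equation and positivity -/

/-- The law of the walk on the event that it has not returned to `x` at a positive time. -/
def tabooLaw (G : SimpleGraph V) [G.LocallyFinite] (d : ℕ) (x : V) : ℕ → (V →₀ ℝ)
  | 0 => Finsupp.single x 1
  | n + 1 => (walkOp G d (tabooLaw G d x n)).erase x

theorem tabooLaw_succ_self (x : V) (n : ℕ) : tabooLaw G d x (n + 1) x = 0 := by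
  simp [tabooLaw]

theorem tabooLaw_succ_of_ne {x y : V} (h : y ≠ x) (n : ℕ) :
    tabooLaw G d x (n + 1) y = walkOp G d (tabooLaw G d x n) y := by
  simp [tabooLaw, Finsupp.erase_ne h]

theorem tabooLaw_nonneg (x : V) (n : ℕ) (y : V) : 0 ≤ tabooLaw G d x n y := by
  induction n generalizing y with
  | zero => exact single_one_nonneg x y
  | succ n ih =>
    rcases eq_or_ne y x with rfl | h
    · rw [tabooLaw_succ_self]
    · rw [tabooLaw_succ_of_ne h]; exact walkOp_nonneg ih y

/-- The first return probabilities, computed with the transition operator. -/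
def firstReturnSeq (G : SimpleGraph V) [G.LocallyFinite] (d : ℕ) (x : V) : ℕ → ℝ
  | 0 => 0
  | n + 1 => walkOp G d (tabooLaw G d x n) x

theorem firstReturnSeq_nonneg (x : V) (n : ℕ) : 0 ≤ firstReturnSeq G d x n := by
  cases n with
  | zero => exact le_rfl
  | succ n => exact walkOp_nonneg (tabooLaw_nonneg x n) x

/-- Either the walk has not yet returned, or it first returned at time `k + 1` and started afresh.
Inductively, one step splits the taboo mass into what lands on `x` and what does not. -/
theorem first_return_decomposition (x : V) (n : ℕ) :
    (walkOp G d ^ n) (Finsupp.single x 1) = tabooLaw G d x n +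
      ∑ k ∈ Finset.range n, firstReturnSeq G d x (k + 1) •
        (walkOp G d ^ (n - 1 - k)) (Finsupp.single x 1) := by
  induction n with
  | zero => simp [tabooLaw]
  | succ n ih =>
    have h1 : walkOp G d (tabooLaw G d x n) = tabooLaw G d x (n + 1) +
        firstReturnSeq G d x (n + 1) • Finsupp.single x (1 : ℝ) := by
      rw [add_comm, Finsupp.smul_single_one]
      exact (Finsupp.single_add_erase x _).symm
    rw [pow_succ', Module.End.mul_apply, ih, map_add, h1, map_sum, Finset.sum_range_succ,
      Nat.add_sub_cancel, Nat.sub_self, pow_zero, Module.End.one_apply]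
    have h2 : ∀ k ∈ Finset.range n, walkOp G d (firstReturnSeq G d x (k + 1) •
        (walkOp G d ^ (n - 1 - k)) (Finsupp.single x 1)) = firstReturnSeq G d x (k + 1) •
        (walkOp G d ^ (n - k)) (Finsupp.single x 1) := by
      intro k hk
      rw [map_smul, ← Module.End.mul_apply, ← pow_succ',
        show n - 1 - k + 1 = n - k by have := Finset.mem_range.mp hk; omega]
    rw [Finset.sum_congr rfl h2]
    abel

theorem firstReturnSeq_renewal (x : V) {n : ℕ} (hn : 1 ≤ n) :
    returnFunctional G d x (Polynomial.X ^ n) = ∑ p ∈ antidiagonal n,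
      firstReturnSeq G d x p.1 * returnFunctional G d x (Polynomial.X ^ p.2) := by
  obtain ⟨n, rfl⟩ := Nat.exists_eq_add_of_le' hn
  rw [Finset.Nat.sum_antidiagonal_eq_sum_range_succ_mk, Finset.sum_range_succ',
    returnFunctional_X_pow, first_return_decomposition, Finsupp.add_apply, tabooLaw_succ_self,
    zero_add, Finsupp.finsetSum_apply]
  simp [firstReturnSeq, returnFunctional_X_pow, Nat.add_sub_add_right]

/-- Before the last step `y → x`, insert a detour `y → z → y` through a neighbour `z ≠ x`, which
exists as the degree is at least two. -/
theorem firstReturnSeq_add_two_pos (hd : ∀ y, G.degree y = d) (hd2 : 2 ≤ d) (x : V) {n : ℕ}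
    (hn : 0 < firstReturnSeq G d x n) : 0 < firstReturnSeq G d x (n + 2) := by
  have hd0 : 0 < d := by omega
  match n, hn with
  | 0, hn => exact absurd hn (lt_irrefl _)
  | 1, hn =>
    obtain ⟨y, hy, hpos⟩ := exists_adj_of_walkOp_pos hn
    have : y = x := by
      by_contra h
      simp [tabooLaw, Ne.symm h] at hpos
    exact absurd (this ▸ hy) (G.loopless.irrefl _)
  | n + 2, hn =>
    obtain ⟨y, hy, hpos⟩ := exists_adj_of_walkOp_pos hn
    have hcard : 1 < (G.neighborFinset y).card := by
      rw [G.card_neighborFinset_eq_degree, hd]; omega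
    obtain ⟨z, hz, hzx⟩ := Finset.exists_mem_ne hcard x
    have hz' : G.Adj y z := by simpa using hz
    have h1 : 0 < tabooLaw G d x (n + 2) z := by
      rw [tabooLaw_succ_of_ne hzx]
      exact walkOp_pos hd0 (tabooLaw_nonneg x _) hz' hpos
    have h2 : 0 < tabooLaw G d x (n + 3) y := by
      rw [tabooLaw_succ_of_ne hy.ne]
      exact walkOp_pos hd0 (tabooLaw_nonneg x _) hz'.symm h1
    exact walkOp_pos hd0 (tabooLaw_nonneg x _) hy h2

theorem firstReturnSeq_two_pos (hd : ∀ y, G.degree y = d) (hd0 : 0 < d) (x : V) :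
    0 < firstReturnSeq G d x 2 := by
  obtain ⟨y, hy⟩ := (G.degree_pos_iff_exists_adj x).mp (by rw [hd]; exact hd0)
  refine walkOp_pos hd0 (tabooLaw_nonneg x _) hy.symm ?_
  rw [tabooLaw_succ_of_ne hy.ne']
  exact walkOp_pos hd0 (tabooLaw_nonneg x _) hy (by simp [tabooLaw])

theorem firstReturnSeq_even_pos (hd : ∀ y, G.degree y = d) (hd2 : 2 ≤ d) (x : V) (k : ℕ) :
    0 < firstReturnSeq G d x (2 * (k + 1)) := by
  induction k with
  | zero => exact firstReturnSeq_two_pos hd (by omega) x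
  | succ k ih => exact firstReturnSeq_add_two_pos hd hd2 x ih

/-- Even `n` are reached from `2` by detours. For odd `n` the renewal equation gives `i + j = n`
with `f_i u_j > 0`; if `i` is odd, add detours to `i`, and otherwise induct on the odd `j < n`. -/
theorem firstReturnSeq_pos (hd : ∀ y, G.degree y = d) (hd2 : 2 ≤ d) (x : V) {n : ℕ}
    (hn : 1 ≤ n) (hu : 0 < returnFunctional G d x (Polynomial.X ^ n)) :
    0 < firstReturnSeq G d x n := by
  induction n using Nat.strong_induction_on with
  | _ n ih =>
    have hadd : ∀ m k, 0 < firstReturnSeq G d x m → 0 < firstReturnSeq G d x (m + 2 * k) := by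
      intro m k h
      induction k with
      | zero => exact h
      | succ k ihk => exact firstReturnSeq_add_two_pos hd hd2 x ihk
    rcases Nat.even_or_odd' n with ⟨k, rfl | rfl⟩
    · obtain ⟨j, rfl⟩ := Nat.exists_eq_add_of_le' (show 1 ≤ k by omega)
      exact firstReturnSeq_even_pos hd hd2 x j
    · have h0 := hu
      rw [firstReturnSeq_renewal x hn] at h0
      obtain ⟨⟨i, j⟩, hij, hpos⟩ := Finset.exists_lt_of_sum_lt (s := antidiagonal (2 * k + 1))
        (f := fun _ => (0 : ℝ)) (by simpa using h0)
      rw [Finset.HasAntidiagonal.mem_antidiagonal] at hij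
      simp only at hij hpos
      have hf : 0 < firstReturnSeq G d x i :=
        (firstReturnSeq_nonneg x i).lt_of_ne' fun h => by simp [h] at hpos
      have hur : 0 < returnFunctional G d x (Polynomial.X ^ j) := pos_of_mul_pos_right hpos hf.le
      have hi : i ≠ 0 := by rintro rfl; exact lt_irrefl _ hf
      rcases Nat.even_or_odd' j with ⟨l, rfl | rfl⟩
      · rw [← hij]; exact hadd _ _ hf
      · have h1 := ih (2 * l + 1) (by omega) (by omega) hur
        have : 2 * k + 1 = (2 * l + 1) + 2 * (k - l) := by omega
        rw [this]; exact hadd _ _ h1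

end Operator

end

end SRW

namespace SRW

open Finset.HasAntidiagonal (antidiagonal)

/-! ### From the path law to the transition operator -/

section PathLaw

variable {V : Type*} {G : SimpleGraph V} [G.LocallyFinite] {d : ℕ}

theorem step_apply [DecidableEq V] [DecidableRel G.Adj] (hd : ∀ y, G.degree y = d) (hd0 : 0 < d)
    (y z : V) : step G y z = if G.Adj y z then (d : ENNReal)⁻¹ else 0 := by
  classical
  have h : (G.neighborFinset y).Nonempty := by
    rw [← Finset.card_pos, G.card_neighborFinset_eq_degree, hd]; exact hd0
  rw [step, dif_pos h, PMF.uniformOfFinset_apply]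
  simp [hd y]

theorem pathLaw_of_degree_zero (hd : ∀ y, G.degree y = 0) (x : V) (n : ℕ) :
    pathLaw G x n = PMF.pure fun _ => x := by
  induction n with
  | zero => rfl
  | succ n ih =>
    have h : ¬ (G.neighborFinset x).Nonempty := by
      rw [Finset.not_nonempty_iff_eq_empty, ← Finset.card_eq_zero,
        G.card_neighborFinset_eq_degree, hd]
    rw [pathLaw, ih, PMF.pure_bind, step, dif_neg h, PMF.pure_map]
    congr 1
    funext i
    refine Fin.lastCases ?_ (fun i => ?_) i <;> simp

theorem returnProb_of_degree_zero (hd : ∀ y, G.degree y = 0) (x : V) (n : ℕ) :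
    returnProb G x n = 1 := by
  classical
  rw [returnProb, pathLaw_of_degree_zero hd, PMF.toOuterMeasure_pure_apply]
  simp

/-- The Markov property. An arbitrary past event `E` covers both uses: no restriction for `u_n`,
avoidance of `x` for `f_n`. -/
theorem pathLaw_succ_toOuterMeasure (hd : ∀ y, G.degree y = d) (hd0 : 0 < d) (x : V) (n : ℕ)
    (E : Set (Fin (n + 1) → V)) (z : V) :
    (pathLaw G x (n + 1)).toOuterMeasure
        {ω | (Fin.init ω : Fin (n + 1) → V) ∈ E ∧ ω (Fin.last (n + 1)) = z} =
      ∑ y ∈ G.neighborFinset z, (d : ENNReal)⁻¹ *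
        (pathLaw G x n).toOuterMeasure {ω | ω ∈ E ∧ ω (Fin.last n) = y} := by
  classical
  simp only [PMF.toOuterMeasure_apply, ← ENNReal.tsum_mul_left]
  rw [← Summable.tsum_finsetSum fun _ _ => ENNReal.summable, ← PMF.toOuterMeasure_apply, pathLaw,
    PMF.toOuterMeasure_bind_apply]
  refine tsum_congr fun ω => ?_
  rw [PMF.toOuterMeasure_map_apply]
  by_cases hω : ω ∈ E
  · have h1 : ((fun y => (Fin.snoc ω y : Fin (n + 2) → V)) ⁻¹'
        {ω | (Fin.init ω : Fin (n + 1) → V) ∈ E ∧ ω (Fin.last (n + 1)) = z}) = {z} := by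
      ext y
      simp [hω]
    rw [h1, PMF.toOuterMeasure_apply_singleton, step_apply hd hd0]
    simp [Set.indicator_apply, hω, Finset.sum_ite_eq, G.adj_comm z, mul_comm]
  · have h1 : ((fun y => (Fin.snoc ω y : Fin (n + 2) → V)) ⁻¹'
        {ω | (Fin.init ω : Fin (n + 1) → V) ∈ E ∧ ω (Fin.last (n + 1)) = z}) = ∅ := by
      ext y
      simp [hω]
    rw [h1]
    simp [hω]

theorem pathLaw_succ_eq_walkOp (hd : ∀ y, G.degree y = d) (hd0 : 0 < d) (x : V) (n : ℕ)
    (E : Set (Fin (n + 1) → V)) (f : V →₀ ℝ) (hf : ∀ y, 0 ≤ f y)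
    (h : ∀ y, (pathLaw G x n).toOuterMeasure {ω | ω ∈ E ∧ ω (Fin.last n) = y} =
      ENNReal.ofReal (f y)) (z : V) :
    (pathLaw G x (n + 1)).toOuterMeasure
        {ω | (Fin.init ω : Fin (n + 1) → V) ∈ E ∧ ω (Fin.last (n + 1)) = z} =
      ENNReal.ofReal (walkOp G d f z) := by
  rw [pathLaw_succ_toOuterMeasure hd hd0, walkOp_apply, Finset.mul_sum,
    ENNReal.ofReal_sum_of_nonneg fun y _ => mul_nonneg (by positivity) (hf y)]
  refine Finset.sum_congr rfl fun y _ => ?_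
  rw [h, ENNReal.ofReal_mul (by positivity), ENNReal.ofReal_inv_of_pos (by positivity),
    ENNReal.ofReal_natCast]

theorem pathLaw_last_eq (hd : ∀ y, G.degree y = d) (hd0 : 0 < d) (x : V) (n : ℕ) (y : V) :
    (pathLaw G x n).toOuterMeasure {ω | ω (Fin.last n) = y} =
      ENNReal.ofReal ((walkOp G d ^ n) (Finsupp.single x 1) y) := by
  classical
  induction n generalizing y with
  | zero =>
    rw [pathLaw, PMF.toOuterMeasure_pure_apply]
    by_cases h : x = y <;> simp [h]
  | succ n ih =>
    have := pathLaw_succ_eq_walkOp hd hd0 x n Set.univ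
      ((walkOp G d ^ n) (Finsupp.single x 1)) (walkOp_pow_nonneg (single_one_nonneg x) n)
      (by simpa using ih) y
    rw [pow_succ', Module.End.mul_apply, ← this]
    simp

theorem returnProb_eq (hd : ∀ y, G.degree y = d) (hd0 : 0 < d) (x : V) (n : ℕ) :
    returnProb G x n = returnFunctional G d x (Polynomial.X ^ n) := by
  rw [returnProb, pathLaw_last_eq hd hd0, ENNReal.toReal_ofReal
    (walkOp_pow_nonneg (single_one_nonneg x) n x), returnFunctional_X_pow]

theorem forall_init_ne_iff {n : ℕ} {x : V} (ω : Fin (n + 2) → V) :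
    (∀ i : Fin (n + 1), 0 < i → (Fin.init ω : Fin (n + 1) → V) i ≠ x) ↔
      ∀ i : Fin (n + 2), 0 < i → i < Fin.last (n + 1) → ω i ≠ x := by
  constructor
  · intro h i hi hl
    have := h (i.castPred hl.ne) (Fin.lt_def.mpr (Fin.lt_def.mp hi))
    simpa [Fin.init] using this
  · intro h i hi
    exact h i.castSucc (Fin.lt_def.mpr (Fin.lt_def.mp hi)) (Fin.castSucc_lt_last i)

theorem pathLaw_taboo_eq (hd : ∀ y, G.degree y = d) (hd0 : 0 < d) (x : V) (n : ℕ) (y : V) :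
    (pathLaw G x n).toOuterMeasure
        {ω | ω ∈ {ω : Fin (n + 1) → V | ∀ i, 0 < i → ω i ≠ x} ∧ ω (Fin.last n) = y} =
      ENNReal.ofReal (tabooLaw G d x n y) := by
  classical
  induction n generalizing y with
  | zero =>
    rw [pathLaw, PMF.toOuterMeasure_pure_apply]
    have h0 : ∀ i : Fin (0 + 1), ¬ 0 < i := fun i hi => by
      have := Fin.lt_def.mp hi
      simp only [Fin.val_zero] at this
      omega
    by_cases h : x = y <;> simp [h, h0, tabooLaw]
  | succ n ih =>
    rcases eq_or_ne y x with rfl | hy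
    · rw [tabooLaw_succ_self, ENNReal.ofReal_zero]
      refine (congrArg _ ?_).trans (pathLaw G y (n + 1)).toOuterMeasure.empty
      rw [Set.eq_empty_iff_forall_notMem]
      rintro ω ⟨h1, h2⟩
      exact h1 (Fin.last (n + 1)) (Fin.last_pos) h2
    · rw [tabooLaw_succ_of_ne hy, ← pathLaw_succ_eq_walkOp hd hd0 x n
        {ω : Fin (n + 1) → V | ∀ i, 0 < i → ω i ≠ x} _ (tabooLaw_nonneg x n) ih y]
      congr 1
      ext ω
      simp only [Set.mem_ofPred_eq, forall_init_ne_iff]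
      constructor
      · rintro ⟨h1, h2⟩
        exact ⟨fun i hi _ => h1 i hi, h2⟩
      · rintro ⟨h1, h2⟩
        refine ⟨fun i hi => ?_, h2⟩
        rcases eq_or_ne i (Fin.last (n + 1)) with rfl | hl
        · rw [h2]; exact hy
        · exact h1 i hi (lt_of_le_of_ne (Fin.le_last i) hl)

theorem firstReturnProb_eq (hd : ∀ y, G.degree y = d) (hd0 : 0 < d) (x : V) (n : ℕ) :
    firstReturnProb G x n = firstReturnSeq G d x n := by
  cases n with
  | zero => simp [firstReturnProb, firstReturnSeq]
  | succ n =>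
    have := pathLaw_succ_eq_walkOp hd hd0 x n
      {ω : Fin (n + 1) → V | ∀ i, 0 < i → ω i ≠ x} _ (tabooLaw_nonneg x n)
      (pathLaw_taboo_eq hd hd0 x n) x
    rw [firstReturnProb, if_neg (Nat.succ_ne_zero n), firstReturnSeq]
    rw [← ENNReal.toReal_ofReal (walkOp_nonneg (d := d) (tabooLaw_nonneg x n) x), ← this]
    congr 2
    ext ω
    simp only [Set.mem_ofPred_eq, forall_init_ne_iff]
    exact and_comm

/-- Transience forces the vertices of a transitive graph to have degree at least two. -/
theorem exists_degree (htrans : IsTransitive G) (htransient : IsTransient G) (x : V) :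
    ∃ d, 2 ≤ d ∧ ∀ y, G.degree y = d := by
  have hd : ∀ y, G.degree y = G.degree x := by
    intro y
    obtain ⟨φ, rfl⟩ := htrans x y
    exact φ.degree_eq x
  refine ⟨G.degree x, ?_, hd⟩
  have hs := (htransient x).tendsto_atTop_zero
  by_contra! hlt
  have hcases : G.degree x = 0 ∨ G.degree x = 1 := by omega
  rcases hcases with h | h
  · have h1 : ∀ n, returnProb G x n = 1 := returnProb_of_degree_zero (by simpa [h] using hd) x
    exact one_ne_zero (tendsto_nhds_unique (tendsto_const_nhds.congr fun n => (h1 n).symm) hs)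
  -- Degree one gives `u_2 = 1`, and `u_{2k} ≥ u_2 ^ k` then contradicts `u_n → 0`.
  · rw [h] at hd
    have hF := isReturnFunctional htrans hd one_pos x
    have h1 : ∀ k, 1 ≤ returnProb G x (2 * k) := by
      intro k
      have := hF.two_pow_le k
      rw [returnFunctional_two hd one_pos] at this
      rw [returnProb_eq hd one_pos]
      simpa using this
    have hmap : Tendsto (fun k : ℕ => 2 * k) atTop atTop :=
      tendsto_atTop_mono (fun k => by dsimp only [id]; omega) tendsto_id
    linarith [ge_of_tendsto' (hs.comp hmap) h1]

end PathLaw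

/-! ### Reduction to multiples of the period, and conclusion -/

section Periodic

variable {a φ : ℕ → ℝ} {D : ℕ}

theorem sum_antidiagonal_mul_of_dvd (hD : 0 < D) (hφ : ∀ n, ¬ D ∣ n → φ n = 0) (k : ℕ) :
    ∑ p ∈ antidiagonal (D * k), φ p.1 * a p.2 =
      ∑ p ∈ antidiagonal k, φ (D * p.1) * a (D * p.2) := by
  symm
  refine Finset.sum_of_injOn (fun p => (D * p.1, D * p.2)) ?_ ?_ ?_ ?_
  · rintro ⟨i, j⟩ _ ⟨i', j'⟩ _ h
    simp only [Prod.mk.injEq] at h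
    rw [Nat.eq_of_mul_eq_mul_left hD h.1, Nat.eq_of_mul_eq_mul_left hD h.2]
  · rintro ⟨i, j⟩ h
    simp only [Finset.mem_coe, Finset.HasAntidiagonal.mem_antidiagonal] at h ⊢
    rw [← mul_add, h]
  · rintro ⟨i, j⟩ h hn
    rw [Finset.HasAntidiagonal.mem_antidiagonal] at h
    by_cases hi : D ∣ i
    · obtain ⟨i', rfl⟩ := hi
      obtain ⟨j', rfl⟩ : D ∣ j := (Nat.dvd_add_right (dvd_mul_right D i')).mp
        (h ▸ dvd_mul_right D k)
      refine absurd ⟨(i', j'), ?_, rfl⟩ hn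
      simp only [Finset.mem_coe, Finset.HasAntidiagonal.mem_antidiagonal]
      rw [← mul_add] at h
      exact Nat.eq_of_mul_eq_mul_left hD h
    · simp [hφ i hi]
  · intros; rfl

/-- The same `N` works: the new middle sum at `k` is a subsum of the old one at `D * k`. -/
theorem SmallMiddleSums.comp_mul (hsm : SmallMiddleSums a) (ha : ∀ n, 0 ≤ a n) (hD : 0 < D) :
    SmallMiddleSums fun k => a (D * k) := by
  intro ε hε
  obtain ⟨N, hN, h⟩ := hsm ε hε
  refine ⟨N, hN, fun k hk => ?_⟩
  have hDk : k ≤ D * k := Nat.le_mul_of_pos_left k hD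
  refine le_trans ?_ (h (D * k) (by omega))
  have hinj : Function.Injective fun i => D * i := fun i j h => Nat.eq_of_mul_eq_mul_left hD h
  calc ∑ i ∈ Finset.Icc N (k - N), a (D * i) * a (D * (k - i))
      = ∑ i ∈ (Finset.Icc N (k - N)).image (fun i => D * i), a i * a (D * k - i) := by
        rw [Finset.sum_image fun i _ j _ h => hinj h]
        exact Finset.sum_congr rfl fun i _ => by rw [Nat.mul_sub]
    _ ≤ _ := by
        refine Finset.sum_le_sum_of_subset_of_nonneg (fun j hj => ?_)
          fun i _ _ => mul_nonneg (ha _) (ha _)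
        obtain ⟨i, hi, rfl⟩ := Finset.mem_image.mp hj
        rw [Finset.mem_Icc] at hi ⊢
        have h1 : i ≤ D * i := Nat.le_mul_of_pos_left i hD
        have h2 : k - i ≤ D * (k - i) := Nat.le_mul_of_pos_left _ hD
        have h3 : D * (k - i) = D * k - D * i := Nat.mul_sub _ _ _
        have h4 : D * i ≤ D * k := Nat.mul_le_mul_left D (by omega)
        omega

/-- The renewal theorem for subexponential renewal sequences of period `D`. -/
theorem periodic_renewal_ratio_tendsto (hD : 0 < D) (ha : ∀ n, 0 ≤ a n) (hφ : ∀ n, 0 ≤ φ n)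
    (ha0 : a 0 = 1) (hφ0 : φ 0 = 0)
    (hren : ∀ n, 1 ≤ n → a n = ∑ p ∈ antidiagonal n, φ p.1 * a p.2)
    (hper : ∀ n, ¬ D ∣ n → a n = 0) (hpos : ∃ n, 1 ≤ n ∧ 0 < a n)
    (haφ : ∀ n, 1 ≤ n → 0 < a n → 0 < φ n)
    (hr : Tendsto (fun k => a (D * (k + 1)) / a (D * k)) atTop (𝓝 1)) (hsm : SmallMiddleSums a) :
    (∃ c : ℝ, 0 < c ∧ ∀ n, 1 ≤ n → φ n ≤ c * a n ∧ a n ≤ c * φ n) ∧ Summable φ ∧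
      Tendsto (fun n => φ n / a n) (atTop ⊓ 𝓟 {n | D ∣ n}) (𝓝 ((1 - ∑' n, φ n) ^ 2)) ∧
      (1 - ∑' n, φ n) ^ 2 ∈ Set.Ioo (0 : ℝ) 1 := by
  have hle := renewal_le ha hφ ha0 hφ0 hren
  have hφper : ∀ n, ¬ D ∣ n → φ n = 0 := fun n hn =>
    le_antisymm (hper n hn ▸ hle n) (hφ n)
  have hinj : Function.Injective fun k => D * k := fun i j h => Nat.eq_of_mul_eq_mul_left hD h
  have hoff : ∀ n, n ∉ Set.range (fun k => D * k) → φ n = 0 := fun n hn =>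
    hφper n fun ⟨k, hk⟩ => hn ⟨k, hk.symm⟩
  have hren' : ∀ k, 1 ≤ k → a (D * k) =
      ∑ p ∈ antidiagonal k, φ (D * p.1) * a (D * p.2) := by
    intro k hk
    rw [hren _ (Nat.mul_pos hD hk), sum_antidiagonal_mul_of_dvd hD hφper]
  have hsm' := hsm.comp_mul ha hD
  have hs := hsm'.summable (fun k => ha _) hr
  have hsφ' : Summable fun k => φ (D * k) :=
    Summable.of_nonneg_of_le (fun k => hφ _) (fun k => hle _) hs
  have hsφ : Summable φ := (hinj.summable_iff hoff).mp hsφ'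
  have htsum : ∑' k, φ (D * k) = ∑' n, φ n :=
    hinj.tsum_eq (f := φ) (Function.support_subset_iff'.mpr hoff)
  have hlim := renewal_ratio_tendsto (b := fun k => a (D * k)) (φ := fun k => φ (D * k))
    (fun k => ha _) (fun k => hφ _) (by simpa using ha0) (by simpa using hφ0) hren' hr hsm'
  have hone := renewal_tsum (b := fun k => a (D * k)) (φ := fun k => φ (D * k))
    (fun k => ha _) (fun k => hφ _) (by simpa using ha0) (by simpa using hφ0) hren' hs
  rw [htsum] at hlim hone
  have hA : 1 < ∑' k, a (D * k) := by
    obtain ⟨n, hn, hpn⟩ := hpos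
    obtain ⟨k, rfl⟩ : D ∣ n := by
      by_contra h
      exact hpn.ne' (hper n h)
    have hk : 0 ≠ k := by rintro rfl; omega
    have := hs.sum_le_tsum {0, k} fun i _ => ha _
    rw [Finset.sum_pair hk, mul_zero, ha0] at this
    linarith
  have hκ0 : 0 < 1 - ∑' n, φ n := by
    by_contra! h
    nlinarith
  have hκ1 : 1 - ∑' n, φ n < 1 := by nlinarith
  refine ⟨?_, hsφ, ?_, pow_pos hκ0 2, pow_lt_one₀ hκ0.le hκ1 two_ne_zero⟩
  -- Convergence bounds `(φ / a)⁻¹` for all indices at once. Positivity of `φ` is still needed, as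
  -- the inverse of `0` is `0` and the bound would then say nothing.
  · obtain ⟨C, hC⟩ := (hlim.inv₀ (pow_pos hκ0 2).ne').bddAbove_range
    refine ⟨max C 1, by positivity, fun n hn => ⟨?_, ?_⟩⟩
    · exact (hle n).trans (le_mul_of_one_le_left (ha n) (le_max_right _ _))
    · rcases (ha n).eq_or_lt with h0 | h0
      · rw [← h0]
        exact mul_nonneg (by positivity) (hφ n)
      · obtain ⟨k, rfl⟩ : D ∣ n := by
          by_contra h
          exact h0.ne' (hper n h)
        have h1 : (φ (D * k) / a (D * k))⁻¹ ≤ C := hC ⟨k, rfl⟩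
        rw [inv_div, div_le_iff₀ (haφ _ hn h0)] at h1
        exact h1.trans (mul_le_mul_of_nonneg_right (le_max_left _ _) (hφ _))
  · intro s hs
    obtain ⟨K, hK⟩ := eventually_atTop.mp (hlim hs)
    rw [mem_map, mem_inf_principal]
    filter_upwards [eventually_ge_atTop (D * K)] with n hn hdvd
    obtain ⟨k, rfl⟩ := hdvd
    exact hK k (Nat.le_of_mul_le_mul_left hn hD)

end Periodic

theorem smallMiddleSums_div_pow_iff {u : ℕ → ℝ} {σ : ℝ} (hσ : 0 < σ) :
    SmallMiddleSums u ↔ SmallMiddleSums fun n => u n / σ ^ n := by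
  refine forall₂_congr fun ε _ => exists_congr fun N => and_congr_right fun _ =>
    forall₂_congr fun n hn => ?_
  have h1 : ∑ i ∈ Finset.Icc N (n - N), u i / σ ^ i * (u (n - i) / σ ^ (n - i)) =
      (∑ i ∈ Finset.Icc N (n - N), u i * u (n - i)) / σ ^ n := by
    rw [Finset.sum_div]
    refine Finset.sum_congr rfl fun i hi => ?_
    rw [div_mul_div_comm, ← pow_add, Nat.add_sub_cancel'
      (by have := (Finset.mem_Icc.mp hi).2; omega)]
  rw [h1, ← mul_div_assoc, div_le_div_iff_of_pos_right (pow_pos hσ n)]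

end SRW

theorem proposition6p1 {V : Type*} (G : SimpleGraph V) [G.LocallyFinite]
    (hconn : G.Connected) (htrans : SRW.IsTransitive G) (htransient : SRW.IsTransient G) (x : V) :
    -- the two forms of the condition are equivalent
    (SRW.SmallMiddleSums (SRW.returnProb G x) ↔
      SRW.SmallMiddleSums (SRW.normalizedReturnProb G x)) ∧
    (SRW.SmallMiddleSums (SRW.returnProb G x) →
      -- `f_n` and `u_n` are of the same order
      (∃ c : ℝ, 0 < c ∧ ∀ n : ℕ, 1 ≤ n →
        SRW.firstReturnProb G x n ≤ c * SRW.returnProb G x n ∧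
        SRW.returnProb G x n ≤ c * SRW.firstReturnProb G x n) ∧
      -- the period is 1 or 2
      (SRW.period G x = 1 ∨ SRW.period G x = 2) ∧
      -- the series `F(ρ⁻¹)` converges
      Summable (fun n : ℕ =>
        SRW.firstReturnProb G x n * (SRW.spectralRadius G x)⁻¹ ^ n) ∧
      -- the limit of `f_n / u_n` along the multiples of the period
      Tendsto (fun n : ℕ => SRW.firstReturnProb G x n / SRW.returnProb G x n)
        (atTop ⊓ 𝓟 {n : ℕ | SRW.period G x ∣ n})
        (𝓝 ((1 - SRW.firstReturnGen G x (SRW.spectralRadius G x)⁻¹) ^ 2)) ∧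
      (1 - SRW.firstReturnGen G x (SRW.spectralRadius G x)⁻¹) ^ 2 ∈ Set.Ioo (0 : ℝ) 1) := by
  obtain ⟨d, hd2, hd⟩ := SRW.exists_degree htrans htransient x
  have hd0 : 0 < d := by omega
  have hℓ := SRW.isReturnFunctional htrans hd hd0 x
  obtain ⟨σ, hσ, hlim, hle⟩ := hℓ.exists_radius
  have hρ : SRW.spectralRadius G x = σ := by
    rw [← hℓ.limsup_eq hσ hlim hle, SRW.spectralRadius]
    simp only [SRW.returnProb_eq hd hd0]
  have hu : ∀ n, SRW.returnFunctional G d x (Polynomial.X ^ n) = SRW.returnProb G x n :=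
    fun n => (SRW.returnProb_eq hd hd0 x n).symm
  have hf : ∀ n, SRW.firstReturnSeq G d x n = SRW.firstReturnProb G x n :=
    fun n => (SRW.firstReturnProb_eq hd hd0 x n).symm
  have hu0 : ∀ n, 0 ≤ SRW.returnProb G x n := fun n => hu n ▸ hℓ.nonneg n
  have hf0 : ∀ n, 0 ≤ SRW.firstReturnProb G x n := fun n => hf n ▸ SRW.firstReturnSeq_nonneg x n
  have hiff := SRW.smallMiddleSums_div_pow_iff (u := SRW.returnProb G x) hσ
  have hnorm : SRW.normalizedReturnProb G x = fun n => SRW.returnProb G x n / σ ^ n := by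
    funext n; rw [SRW.normalizedReturnProb, hρ]
  refine ⟨by rw [hnorm]; exact hiff, fun hsm => ?_⟩
  have hu2 : 0 < SRW.returnProb G x 2 := hu 2 ▸ hℓ.two_pos
  have hper : SRW.period G x = 1 ∨ SRW.period G x = 2 :=
    (Nat.dvd_prime Nat.prime_two).mp (Nat.setGcd_dvd_of_mem ⟨one_le_two, hu2⟩)
  have hD : 0 < SRW.period G x := by omega
  have hoff : ∀ n, ¬ SRW.period G x ∣ n → SRW.returnProb G x n / σ ^ n = 0 := by
    intro n hn
    have hn1 : 1 ≤ n := Nat.one_le_iff_ne_zero.mpr fun h => hn (h ▸ dvd_zero _)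
    rw [le_antisymm (not_lt.mp fun h => hn (Nat.setGcd_dvd_of_mem ⟨hn1, h⟩)) (hu0 n), zero_div]
  have hr : Tendsto (fun k => (SRW.returnProb G x (SRW.period G x * (k + 1)) /
      σ ^ (SRW.period G x * (k + 1))) / (SRW.returnProb G x (SRW.period G x * k) /
      σ ^ (SRW.period G x * k))) atTop (𝓝 1) := by
    rcases hper with h | h
    -- Without a possible odd return time, `2` would divide the period.
    · obtain ⟨j, hj⟩ : ∃ j, 0 < SRW.returnProb G x (2 * j + 1) := by
        by_contra! hno
        have : 2 ∣ SRW.period G x := by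
          refine Nat.dvd_setGcd_iff.mpr fun n hn => ?_
          obtain ⟨k, rfl | rfl⟩ := Nat.even_or_odd' n
          · exact dvd_mul_right 2 k
          · exact absurd hn.2 (hno k).not_gt
        omega
      have := hℓ.normalized_ratio_tendsto hσ hlim hle (j := j) (by rw [hu]; exact hj)
      simpa only [h, one_mul, hu] using this
    · simp only [h]
      have := hlim.div_const (σ ^ 2)
      rw [div_self (by positivity)] at this
      refine this.congr fun k => ?_
      rw [hu, hu, mul_add, mul_one, pow_add]
      field_simp
  obtain ⟨⟨c, hc, hcomp⟩, hsum, htend, hIoo⟩ := SRW.periodic_renewal_ratio_tendsto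
    (a := fun n => SRW.returnProb G x n / σ ^ n)
    (φ := fun n => SRW.firstReturnProb G x n / σ ^ n) hD
    (fun n => div_nonneg (hu0 n) (by positivity)) (fun n => div_nonneg (hf0 n) (by positivity))
    (by simp [← hu, hℓ.one]) (by simp [SRW.firstReturnProb])
    (fun n hn => by
      have := SRW.firstReturnSeq_renewal (G := G) (d := d) x hn
      simp only [hu, hf] at this
      rw [this, Finset.sum_div]
      refine Finset.sum_congr rfl fun p hp => ?_
      rw [div_mul_div_comm, ← pow_add, Finset.HasAntidiagonal.mem_antidiagonal.mp hp])
    hoff ⟨2, one_le_two, div_pos hu2 (by positivity)⟩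
    (fun n hn h => by
      refine div_pos ?_ (by positivity)
      rw [← hf]
      refine SRW.firstReturnSeq_pos hd hd2 x hn ?_
      rw [hu]
      exact (div_pos_iff_of_pos_right (by positivity)).mp h)
    hr (hiff.mp hsm)
  have hgen : (fun n => SRW.firstReturnProb G x n * (SRW.spectralRadius G x)⁻¹ ^ n) =
      fun n => SRW.firstReturnProb G x n / σ ^ n := by
    funext n
    rw [hρ, inv_pow, div_eq_mul_inv]
  have hF : SRW.firstReturnGen G x (SRW.spectralRadius G x)⁻¹ =
      ∑' n, SRW.firstReturnProb G x n / σ ^ n := by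
    rw [SRW.firstReturnGen, hgen]
  rw [hF, hgen]
  refine ⟨⟨c, hc, fun n hn => ?_⟩, hper, hsum, ?_, hIoo⟩
  · have := hcomp n hn
    simp only [← mul_div_assoc] at this
    rwa [div_le_div_iff_of_pos_right (by positivity),
      div_le_div_iff_of_pos_right (by positivity)] at this
  · exact htend.congr fun n => div_div_div_cancel_right₀ (by positivity) _ _
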